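/- All posets are finite and have a unique minimal element $\hat 0$ and a unique maximal element $\hat 1$. A graded poset with rank function $\rho$ is a \emph{Sheffer poset} if any two intervals $[\hat 0,y]$, $[\hat 0,v]$ with $\rho(y)=\rho(v)=n$ have the same number $D(n)$ of maximal chains, and any two intervals $[x,y]$, $[u,v]$ with $x,u\neq\hat 0$ and $\rho(y)-\rho(x)=\rho(v)-\rho(u)=n$ have the same number $B(n)$ of maximal chains; $B$ and $D$ are its binomial and Sheffer factorial functions. It is \emph{Eulerian} if every non-singleton interval has as many elements of even rank as of odd rank. Let $B_n$ (with a subscript) denote the boolean lattice of all subsets of $\{1,\dots,n\}$, let $\boxplus^{\alpha}(Q)$ denote the poset obtained from $\alpha$ copies of $Q$ by identifying all the minimal elements and identifying all the maximal elements, and let the dual suspension $\Sigma^{*}(Q)$ be the poset obtained from $Q$ by adding two new incomparable elements $a_1,a_2$ with $\hat 0<a_i<y$ for all $y>\hat 0$ in $Q$. \textbf{Theorem.} Let $P$ be an Eulerian Sheffer poset of even rank $n=2m+2\ge 4$ with $B(3)=3!=6$ and $D(3)=4$. Then $\alpha=\dfrac{B(2m+1)}{(2m+1)!}$ is a positive integer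 and $P$ is isomorphic to $\Sigma^{*}\bigl(\boxplus^{\alpha}(B_{2m+1})\bigr)$. Moreover, $P$ has the following binomial and Sheffer factorial functions: \begin{itemize} \item $B(k)=k!$ for $1\le k\le 2m$, and $B(2m+1)=\alpha\,(2m+1)!$; \item $D(1)=1$, $D(k)=2\,(k-1)!$ for $2\le k\le 2m+1$, and $D(2m+2)=2\alpha\,(2m+1)!$. \end{itemize} -/

import Mathlib

/-- The number of maximal chains of the interval `[x, y]`. -/
noncomputable def numMaxChains {P : Type*} [PartialOrder P] (x y : P) : ℕ :=
  Nat.card (Flag (Set.Icc x y))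

/-- A graded poset is Eulerian if every non-singleton interval has as many elements of even rank
as elements of odd rank. (Counting ranks in `P` or inside the interval makes no difference: it
at most exchanges the two numbers.) -/
def IsEulerianPoset (P : Type*) [PartialOrder P] [GradeMinOrder ℕ P] : Prop :=
  ∀ x y : P, x < y →
    {z : P | z ∈ Set.Icc x y ∧ Even (grade ℕ z)}.ncard =
      {z : P | z ∈ Set.Icc x y ∧ Odd (grade ℕ z)}.ncard

/-- A (finite) Sheffer poset: the number of maximal chains of an interval `[⊥, y]` depends only on
the rank of `y`, and the number of maximal chains of an interval `[x, y]` with `x ≠ ⊥` depends only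
on the length of that interval. -/
structure IsShefferPoset (P : Type*) [PartialOrder P] [BoundedOrder P] [GradeMinOrder ℕ P] :
    Prop where
  finite : Finite P
  sheffer : ∀ y v : P, grade ℕ y = grade ℕ v → numMaxChains ⊥ y = numMaxChains ⊥ v
  binomial : ∀ x y u v : P, x ≠ ⊥ → u ≠ ⊥ → x ≤ y → u ≤ v →
    grade ℕ y - grade ℕ x = grade ℕ v - grade ℕ u → numMaxChains x y = numMaxChains u v

/-- `B` is the binomial factorial function of `P`: every `n`-interval `[x, y]` with `x ≠ ⊥` has
`B n` maximal chains. -/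
def IsBinomialFactorialFunction (P : Type*) [PartialOrder P] [BoundedOrder P] [GradeMinOrder ℕ P]
    (B : ℕ → ℕ) : Prop :=
  ∀ x y : P, x ≠ ⊥ → x ≤ y → numMaxChains x y = B (grade ℕ y - grade ℕ x)

/-- `D` is the Sheffer factorial function of `P`: every `n`-interval `[⊥, y]` has
`D n` maximal chains. -/
def IsShefferFactorialFunction (P : Type*) [PartialOrder P] [BoundedOrder P] [GradeMinOrder ℕ P]
    (D : ℕ → ℕ) : Prop :=
  ∀ y : P, numMaxChains ⊥ y = D (grade ℕ y)

/-- The boolean lattice of rank `n`: subsets of an `n`-element set, ordered by inclusion. -/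
abbrev BooleanLattice (n : ℕ) : Type := Finset (Fin n)

/-- The `k`-summation of a bounded poset `P` with `⊥ ≠ ⊤`: all minimal elements and all maximal
elements of `k` copies of `P` are identified. The order on the sigma type is that of a disjoint
union (elements of different copies are incomparable); `WithBot` and `WithTop` add the common least
and greatest elements. -/
abbrev KSummation (k : ℕ) (P : Type*) [PartialOrder P] [BoundedOrder P] [Nontrivial P] : Type _ :=
  WithBot (WithTop (Σ _ : Fin k, Set.Ioo (⊥ : P) ⊤))

/-- The dual suspension of a poset `P` with `⊥`: two new incomparable elements are inserted between
`⊥` and all other elements. Here `Unit ⊕ Unit` is the two-element antichain, and in the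
lexicographic (ordinal) sum it lies entirely below the part `(⊥, ∞)` of `P`. -/
abbrev DualSuspension (P : Type*) [PartialOrder P] [OrderBot P] : Type _ :=
  WithBot ((Unit ⊕ Unit) ⊕ₗ Set.Ioi (⊥ : P))

/-!
The Eulerian relations, divided by the number of maximal chains, become alternating recursions
for `1 / B` and `1 / D`. The recursion for `B` determines `B k` at even `k` only; at odd `k`,
`B 3 = 3!` forces the intervals above an atom to have an open part that is a disjoint union of
open parts of boolean lattices, so that `B k = c * k!` with `c` a positive integer, and the
recursion one rank higher leaves only `c = 1`, unless `k` is the corank of an atom. For `D`, the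
recursion leaves a value undetermined at every second rank; there the number of atoms below an
element is less than four, and it is even since the atoms come in pairs, two atoms being paired when
they lie below a common proper element. Hence every element of rank at least two lies above exactly
two atoms, and these are the two atoms of `P`: it is the dual suspension of its upper part.
-/

open Finset

open scoped Nat

section MaximalChains

variable {P : Type*} [PartialOrder P] {x y a z : P} {s : Set P}

/-- The maximal chains of `[x, y]`, as sets of elements of the ambient poset: a set is a maximal
chain precisely if it consists of the elements comparable with all of its members. -/
def maxChainsIn (x y : P) : Set (Set P) :=
  {s | ∀ z, z ∈ s ↔ z ∈ Set.Icc x y ∧ ∀ w ∈ s, z ≤ w ∨ w ≤ z}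

lemma image_flag_mem_maxChainsIn (F : Flag (Set.Icc x y)) :
    Subtype.val '' (F : Set (Set.Icc x y)) ∈ maxChainsIn x y := by
  intro z
  constructor
  · rintro ⟨z, hz, rfl⟩
    exact ⟨z.2, fun _ ⟨w, hw, hwz⟩ => hwz ▸ F.le_or_le hz hw⟩
  · rintro ⟨hz, hcomp⟩
    exact ⟨⟨z, hz⟩, F.mem_iff_forall_le_or_ge.2 fun w hw => hcomp w ⟨w, hw, rfl⟩, rfl⟩

lemma isMaxChain_preimage_of_mem_maxChainsIn (hs : s ∈ maxChainsIn x y) :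
    IsMaxChain (· ≤ ·) (Subtype.val ⁻¹' s : Set (Set.Icc x y)) := by
  refine ⟨fun z hz w hw _ => ((hs z).1 hz).2 w hw, fun t ht hst => ?_⟩
  refine hst.antisymm fun z hz => (hs z).2 ⟨z.2, fun w hw => ?_⟩
  exact ht.total hz (hst (show (⟨w, ((hs w).1 hw).1⟩ : Set.Icc x y) ∈ _ from hw))

lemma numMaxChains_eq_card (x y : P) : numMaxChains x y = Nat.card (maxChainsIn x y) := by
  refine Nat.card_eq_of_bijective
    (fun F : Flag (Set.Icc x y) => ⟨_, image_flag_mem_maxChainsIn F⟩) ⟨fun F G h => ?_, ?_⟩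
  · exact SetLike.coe_injective
      (Set.image_injective.2 Subtype.val_injective (congrArg Subtype.val h))
  · rintro ⟨s, hs⟩
    refine ⟨Flag.ofIsMaxChain _ (isMaxChain_preimage_of_mem_maxChainsIn hs), Subtype.ext ?_⟩
    exact Subtype.image_preimage_coe _ _ |>.trans
      (Set.inter_eq_right.2 fun z hz => ((hs z).1 hz).1)

lemma left_mem_of_mem_maxChainsIn (hs : s ∈ maxChainsIn x y) (hxy : x ≤ y) : x ∈ s :=
  (hs x).2 ⟨Set.left_mem_Icc.2 hxy, fun w hw => Or.inl ((hs w).1 hw).1.1⟩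

lemma right_mem_of_mem_maxChainsIn (hs : s ∈ maxChainsIn x y) (hxy : x ≤ y) : y ∈ s :=
  (hs y).2 ⟨Set.right_mem_Icc.2 hxy, fun w hw => Or.inr ((hs w).1 hw).1.2⟩

lemma maxChainsIn_self (x : P) : maxChainsIn x x = {{x}} := by
  refine Set.eq_singleton_iff_unique_mem.2 ⟨fun z => ?_, fun s hs => ?_⟩
  · simp only [Set.mem_singleton_iff, Set.Icc_self, forall_eq]
    exact ⟨fun h => ⟨h, Or.inl h.le⟩, And.left⟩
  · refine Set.Subset.antisymm (fun z hz => ?_)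
      (Set.singleton_subset_iff.2 (left_mem_of_mem_maxChainsIn hs le_rfl))
    simpa only [Set.Icc_self] using ((hs z).1 hz).1

lemma numMaxChains_self (x : P) : numMaxChains x x = 1 := by
  rw [numMaxChains_eq_card, maxChainsIn_self, Nat.card_unique]

lemma insert_mem_maxChainsIn (hxa : x ⋖ a) (hay : a ≤ y) (hs : s ∈ maxChainsIn a y) :
    insert x s ∈ maxChainsIn x y := by
  have hax : ∀ w ∈ s, x ≤ w := fun w hw => hxa.le.trans ((hs w).1 hw).1.1
  intro z
  simp only [Set.mem_insert_iff, forall_eq_or_imp]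
  constructor
  · rintro (rfl | hz)
    · exact ⟨⟨le_rfl, hxa.le.trans hay⟩, Or.inl le_rfl, fun w hw => Or.inl (hax w hw)⟩
    · exact ⟨⟨hax z hz, ((hs z).1 hz).1.2⟩, Or.inr (hax z hz), ((hs z).1 hz).2⟩
  · rintro ⟨hz, -, hcomp⟩
    refine hz.1.eq_or_lt.imp Eq.symm fun hxz => (hs z).2 ⟨⟨?_, hz.2⟩, hcomp⟩
    rcases hcomp a (left_mem_of_mem_maxChainsIn hs hay) with hza | haz
    · exact (eq_of_le_of_not_lt hza (hxa.2 hxz)).ge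
    · exact haz

lemma diff_singleton_mem_maxChainsIn (hs : s ∈ maxChainsIn x y) (hxa : x < a)
    (ha : ∀ w ∈ s, w ≠ x → a ≤ w) : s \ {x} ∈ maxChainsIn a y := by
  intro z
  constructor
  · rintro ⟨hz, hzx⟩
    exact ⟨⟨ha z hz hzx, ((hs z).1 hz).1.2⟩, fun w hw => ((hs z).1 hz).2 w hw.1⟩
  · rintro ⟨hz, hcomp⟩
    have hxz : x < z := hxa.trans_le hz.1
    refine ⟨(hs z).2 ⟨⟨hxz.le, hz.2⟩, fun w hw => ?_⟩, hxz.ne'⟩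
    rcases eq_or_ne w x with rfl | hwx
    · exact Or.inr hxz.le
    · exact hcomp w ⟨hw, hwx⟩

variable [LocallyFiniteOrder P]

lemma numMaxChains_pos (x y : P) : 0 < numMaxChains x y := by
  have : Nonempty (Flag (Set.Icc x y)) := by
    obtain ⟨c, hc, -⟩ := IsChain.empty.exists_maxChain (α := Set.Icc x y) (r := (· ≤ ·))
    exact ⟨Flag.ofIsMaxChain c hc⟩
  have : Finite (Flag (Set.Icc x y)) := Finite.of_injective _ SetLike.coe_injective
  exact Nat.card_pos

lemma exists_covBy_of_mem_maxChainsIn (hxy : x < y) (hs : s ∈ maxChainsIn x y) :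
    ∃ a, x ⋖ a ∧ a ≤ y ∧ ∀ w ∈ s, w ≠ x → a ≤ w := by
  have hfin : (s \ {x}).Finite :=
    (Set.finite_Icc x y).subset fun w hw => ((hs w).1 hw.1).1
  obtain ⟨a, ha, hmin⟩ := hfin.exists_minimal ⟨y, right_mem_of_mem_maxChainsIn hs hxy.le, hxy.ne'⟩
  have haI := ((hs a).1 ha.1).1
  have hleast : ∀ w ∈ s, w ≠ x → a ≤ w := fun w hw hwx =>
    (((hs a).1 ha.1).2 w hw).elim id (hmin ⟨hw, hwx⟩)
  refine ⟨a, ⟨lt_of_le_of_ne haI.1 (Ne.symm ha.2), fun c hxc hca => ?_⟩, haI.2, hleast⟩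
  refine (hleast c ((hs c).2 ⟨⟨hxc.le, hca.le.trans haI.2⟩, fun w hw => ?_⟩) hxc.ne').not_gt hca
  rcases eq_or_ne w x with rfl | hwx
  · exact Or.inr hxc.le
  · exact Or.inl (hca.le.trans (hleast w hw hwx))

open scoped Classical in
/-- The atoms of the interval `[x, y]`. -/
noncomputable def atomsIn (x y : P) : Finset P := {a ∈ Icc x y | x ⋖ a}

lemma mem_atomsIn : a ∈ atomsIn x y ↔ x ⋖ a ∧ a ≤ y := by
  simp only [atomsIn, mem_filter, mem_Icc]
  exact ⟨fun h => ⟨h.2, h.1.2⟩, fun h => ⟨⟨h.1.le, h.2⟩, h.1⟩⟩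

lemma atomsIn_mono (hyz : y ≤ z) : atomsIn x y ⊆ atomsIn x z := fun _ ha =>
  mem_atomsIn.2 ⟨(mem_atomsIn.1 ha).1, (mem_atomsIn.1 ha).2.trans hyz⟩

lemma atomsIn_nonempty (hxy : x < y) : (atomsIn x y).Nonempty := by
  obtain ⟨a, hxa, hay⟩ := exists_covBy_le_of_lt hxy
  exact ⟨a, mem_atomsIn.2 ⟨hxa, hay⟩⟩

lemma atomsIn_eq_singleton (hxy : x ⋖ y) : atomsIn x y = {y} := by
  refine eq_singleton_iff_unique_mem.2 ⟨mem_atomsIn.2 ⟨hxy, le_rfl⟩, fun a ha => ?_⟩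
  exact eq_of_le_of_not_lt (mem_atomsIn.1 ha).2 (hxy.2 (mem_atomsIn.1 ha).1.lt)

lemma insert_maxChainsIn_bijective (hxy : x < y) :
    Function.Bijective fun p : Σ a : atomsIn x y, maxChainsIn (a : P) y =>
      (⟨insert x p.2.1, insert_mem_maxChainsIn (mem_atomsIn.1 p.1.2).1 (mem_atomsIn.1 p.1.2).2
        p.2.2⟩ : maxChainsIn x y) := by
  constructor
  · rintro ⟨⟨a, ha⟩, s, hs⟩ ⟨⟨b, hb⟩, t, ht⟩ hst
    rw [mem_atomsIn] at ha hb
    have hxs : x ∉ s := fun h => ((hs x).1 h).1.1.not_gt ha.1.lt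
    have hxt : x ∉ t := fun h => ((ht x).1 h).1.1.not_gt hb.1.lt
    have hins : insert x s = insert x t := congrArg Subtype.val hst
    obtain rfl : s = t := by
      rw [← Set.insert_sdiff_self_of_notMem hxs, ← Set.insert_sdiff_self_of_notMem hxt, hins]
    obtain rfl : a = b := le_antisymm ((hs b).1 (left_mem_of_mem_maxChainsIn ht hb.2)).1.1
      ((ht a).1 (left_mem_of_mem_maxChainsIn hs ha.2)).1.1
    rfl
  · rintro ⟨s, hs⟩
    obtain ⟨a, hxa, hay, hleast⟩ := exists_covBy_of_mem_maxChainsIn hxy hs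
    refine ⟨⟨⟨a, mem_atomsIn.2 ⟨hxa, hay⟩⟩, s \ {x},
      diff_singleton_mem_maxChainsIn hs hxa.lt hleast⟩, Subtype.ext ?_⟩
    exact Set.insert_sdiff_self_of_mem (left_mem_of_mem_maxChainsIn hs hxy.le)

lemma numMaxChains_eq_sum (hxy : x < y) :
    numMaxChains x y = ∑ a ∈ atomsIn x y, numMaxChains a y := by
  simp_rw [numMaxChains_eq_card]
  rw [← Finset.sum_coe_sort, ← Nat.card_eq_of_bijective _ (insert_maxChainsIn_bijective hxy)]
  have (a : P) : Finite (maxChainsIn a y) :=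
    Nat.finite_of_card_ne_zero (numMaxChains_eq_card a y ▸ (numMaxChains_pos a y).ne')
  exact Nat.card_sigma

end MaximalChains

section Levels

variable {P : Type*} [PartialOrder P] [GradeOrder ℕ P] {x y z a : P} {i k : ℕ}

lemma grade_of_covBy (h : x ⋖ a) : grade ℕ a = grade ℕ x + 1 :=
  (Nat.covBy_iff_add_one_eq.1 (h.grade ℕ)).symm

lemma eq_of_le_of_grade_eq (h : x ≤ y) (hg : grade ℕ x = grade ℕ y) : x = y :=
  eq_of_le_of_not_lt h fun hlt => (grade_strictMono (𝕆 := ℕ) hlt).ne hg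

lemma covBy_of_le_of_grade_eq_add_one (h : x ≤ y) (hg : grade ℕ y = grade ℕ x + 1) : x ⋖ y := by
  refine ⟨lt_of_le_of_ne h (by rintro rfl; omega), fun c hxc hcy => ?_⟩
  have h₁ := grade_strictMono (𝕆 := ℕ) hxc
  have h₂ := grade_strictMono (𝕆 := ℕ) hcy
  omega

variable [LocallyFiniteOrder P]

/-- The elements of rank `i` of the interval `[x, y]`, the rank being counted from `x`. -/
def levelIn (x y : P) (i : ℕ) : Finset P := {z ∈ Icc x y | grade ℕ z = grade ℕ x + i}

lemma mem_levelIn : z ∈ levelIn x y i ↔ x ≤ z ∧ z ≤ y ∧ grade ℕ z = grade ℕ x + i := by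
  simp only [levelIn, mem_filter, mem_Icc, and_assoc]

lemma levelIn_zero (hxy : x ≤ y) : levelIn x y 0 = {x} :=
  eq_singleton_iff_unique_mem.2 ⟨mem_levelIn.2 ⟨le_rfl, hxy, rfl⟩, fun _ hz =>
    (eq_of_le_of_grade_eq (mem_levelIn.1 hz).1 (mem_levelIn.1 hz).2.2.symm).symm⟩

lemma sum_levelIn_numMaxChains_mul (hxy : x ≤ y) (hi : grade ℕ x + i ≤ grade ℕ y) :
    ∑ z ∈ levelIn x y i, numMaxChains x z * numMaxChains z y = numMaxChains x y := by
  induction i generalizing x with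
  | zero => rw [levelIn_zero hxy, sum_singleton, numMaxChains_self, one_mul]
  | succ i ih =>
    have hxy' : x < y := lt_of_le_of_ne hxy (by rintro rfl; omega)
    calc ∑ z ∈ levelIn x y (i + 1), numMaxChains x z * numMaxChains z y
        = ∑ z ∈ levelIn x y (i + 1), ∑ a ∈ atomsIn x z, numMaxChains a z * numMaxChains z y := by
          refine sum_congr rfl fun z hz => ?_
          rw [mem_levelIn] at hz
          rw [numMaxChains_eq_sum (lt_of_le_of_ne hz.1 (by rintro rfl; omega)), sum_mul]
      _ = ∑ a ∈ atomsIn x y, ∑ z ∈ levelIn a y i, numMaxChains a z * numMaxChains z y := by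
          refine sum_comm' fun z a => ?_
          simp only [mem_levelIn, mem_atomsIn]
          constructor
          · rintro ⟨⟨-, hzy, hz⟩, hxa, haz⟩
            exact ⟨⟨haz, hzy, by rw [hz, grade_of_covBy hxa]; ring⟩, hxa, haz.trans hzy⟩
          · rintro ⟨⟨haz, hzy, hz⟩, hxa, -⟩
            exact ⟨⟨hxa.le.trans haz, hzy, by rw [hz, grade_of_covBy hxa]; ring⟩, hxa, haz⟩
      _ = ∑ a ∈ atomsIn x y, numMaxChains a y := by
          refine sum_congr rfl fun a ha => ih (mem_atomsIn.1 ha).2 ?_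
          rw [grade_of_covBy (mem_atomsIn.1 ha).1]
          omega
      _ = numMaxChains x y := (numMaxChains_eq_sum hxy').symm

lemma card_levelIn_mul {w : ℕ} (hxy : x ≤ y) (hi : grade ℕ x + i ≤ grade ℕ y)
    (hw : ∀ z ∈ levelIn x y i, numMaxChains x z * numMaxChains z y = w) :
    #(levelIn x y i) * w = numMaxChains x y := by
  rw [← sum_levelIn_numMaxChains_mul hxy hi, sum_congr rfl hw, sum_const, smul_eq_mul]

lemma exists_grade_eq (hxy : x ≤ y) (hi : grade ℕ x + i ≤ grade ℕ y) :
    ∃ z, x ≤ z ∧ z ≤ y ∧ grade ℕ z = grade ℕ x + i := by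
  have hsum := sum_levelIn_numMaxChains_mul hxy hi
  obtain ⟨z, hz, -⟩ := exists_ne_zero_of_sum_ne_zero (hsum.trans_ne (numMaxChains_pos x y).ne')
  exact ⟨z, mem_levelIn.1 hz⟩

lemma sum_range_sum_levelIn {M : Type*} [AddCommMonoid M] (f : P → M)
    (hk : grade ℕ y = grade ℕ x + k) :
    ∑ i ∈ range (k + 1), ∑ z ∈ levelIn x y i, f z = ∑ z ∈ Icc x y, f z := by
  have hmaps : ∀ z ∈ Icc x y, grade ℕ z - grade ℕ x ∈ range (k + 1) := fun z hz => by
    have := grade_mono (𝕆 := ℕ) (mem_Icc.1 hz).2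
    rw [mem_range]
    omega
  rw [← sum_fiberwise_of_maps_to hmaps]
  refine sum_congr rfl fun i _ => sum_congr ?_ fun _ _ => rfl
  refine filter_congr fun z hz => ?_
  have := grade_mono (𝕆 := ℕ) (mem_Icc.1 hz).1
  omega

end Levels

namespace IsEulerianPoset

variable {P : Type*} [PartialOrder P] [GradeMinOrder ℕ P] [LocallyFiniteOrder P] {x y : P} {k : ℕ}

lemma sum_Icc_neg_one_pow_grade (hE : IsEulerianPoset P) (hxy : x < y) :
    ∑ z ∈ Icc x y, (-1 : ℚ) ^ grade ℕ z = 0 := by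
  have hcard : #{z ∈ Icc x y | Even (grade ℕ z)} = #{z ∈ Icc x y | ¬Even (grade ℕ z)} := by
    simpa only [← Set.ncard_coe_finset, coe_filter, mem_Icc, Set.mem_Icc, Nat.not_even_iff_odd]
      using hE x y hxy
  rw [← sum_filter_add_sum_filter_not _ fun z => Even (grade ℕ z),
    sum_congr rfl fun z hz => (mem_filter.1 hz).2.neg_one_pow,
    sum_congr rfl fun z hz => (Nat.not_even_iff_odd.1 (mem_filter.1 hz).2).neg_one_pow,
    sum_const, sum_const, hcard, smul_neg, add_neg_cancel]

lemma sum_neg_one_pow_mul_card_levelIn (hE : IsEulerianPoset P) (hxy : x < y)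
    (hk : grade ℕ y = grade ℕ x + k) :
    ∑ i ∈ range (k + 1), (-1 : ℚ) ^ i * #(levelIn x y i) = 0 := by
  refine (mul_eq_zero_iff_left (pow_ne_zero (grade ℕ x) (neg_ne_zero.2 one_ne_zero))).1 ?_
  rw [← hE.sum_Icc_neg_one_pow_grade hxy, ← sum_range_sum_levelIn _ hk, mul_sum]
  refine sum_congr rfl fun i _ => ?_
  rw [sum_congr rfl fun z hz => by rw [(mem_levelIn.1 hz).2.2], sum_const, nsmul_eq_mul, pow_add]
  ring

/-- `w i` stands for the number of maximal chains of `[x, y]` through an element of rank `i`, so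
that there are `numMaxChains x y / w i` such elements. -/
lemma sum_neg_one_pow_div_eq_zero (hE : IsEulerianPoset P) (hxy : x < y)
    (hk : grade ℕ y = grade ℕ x + k) {w : ℕ → ℕ}
    (hw : ∀ i, ∀ z ∈ levelIn x y i, numMaxChains x z * numMaxChains z y = w i) :
    ∑ i ∈ range (k + 1), (-1 : ℚ) ^ i / w i = 0 := by
  have htotal : (numMaxChains x y : ℚ) ≠ 0 := by exact_mod_cast (numMaxChains_pos x y).ne'
  refine (mul_eq_zero_iff_left htotal).1 ?_
  rw [← hE.sum_neg_one_pow_mul_card_levelIn hxy hk, mul_sum]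
  refine sum_congr rfl fun i hi => ?_
  have hcard : (#(levelIn x y i) * w i : ℚ) = numMaxChains x y := by
    exact_mod_cast card_levelIn_mul hxy.le (by rw [mem_range] at hi; omega) (hw i)
  have hwi : (w i : ℚ) ≠ 0 := fun h => htotal (by rw [← hcard, h, mul_zero])
  rw [← hcard]
  field_simp

end IsEulerianPoset

section BooleanIntervals

variable {P : Type*} [PartialOrder P] [LocallyFiniteOrder P] {x y z w a b : P}

lemma atomsIn_self (x : P) : atomsIn x x = ∅ :=
  eq_empty_of_forall_notMem fun _ ha => (mem_atomsIn.1 ha).1.lt.not_ge (mem_atomsIn.1 ha).2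

/-- The interval `[x, y]` is a boolean lattice: sending an element to the set of atoms of `[x, y]`
below it identifies `[x, y]` with the lattice of all sets of atoms. -/
structure IsBooleanInterval (x y : P) : Prop where
  le_of_atomsIn_subset : ∀ z ∈ Icc x y, ∀ w ∈ Icc x y, atomsIn x z ⊆ atomsIn x w → z ≤ w
  exists_atomsIn_eq : ∀ S ⊆ atomsIn x y, ∃ z ∈ Icc x y, atomsIn x z = S

namespace IsBooleanInterval

lemma of_Ioo (hxy : x ≤ y)
    (hle : ∀ z ∈ Ioo x y, ∀ w ∈ Ioo x y, atomsIn x z ⊆ atomsIn x w → z ≤ w)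
    (hne : ∀ z ∈ Ioo x y, atomsIn x z ≠ atomsIn x y)
    (hex : ∀ S ⊂ atomsIn x y, S.Nonempty → ∃ z ∈ Ioo x y, atomsIn x z = S) :
    IsBooleanInterval x y where
  le_of_atomsIn_subset z hz w hw hzw := by
    rw [mem_Icc] at hz hw
    rcases hz.1.eq_or_lt with rfl | hxz
    · exact hw.1
    rcases hw.2.eq_or_lt with rfl | hwy
    · exact hz.2
    rcases hw.1.eq_or_lt with rfl | hxw
    · rw [atomsIn_self, subset_empty] at hzw
      exact absurd hzw (atomsIn_nonempty hxz).ne_empty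
    rcases hz.2.eq_or_lt with rfl | hzy
    · exact absurd ((atomsIn_mono hw.2).antisymm hzw) (hne w (mem_Ioo.2 ⟨hxw, hwy⟩))
    · exact hle z (mem_Ioo.2 ⟨hxz, hzy⟩) w (mem_Ioo.2 ⟨hxw, hwy⟩) hzw
  exists_atomsIn_eq S hS := by
    rcases S.eq_empty_or_nonempty with rfl | hS₀
    · exact ⟨x, left_mem_Icc.2 hxy, atomsIn_self x⟩
    rcases hS.eq_or_ssubset with rfl | hS
    · exact ⟨y, right_mem_Icc.2 hxy, rfl⟩
    · exact (hex S hS hS₀).imp fun z hz => ⟨Ioo_subset_Icc_self hz.1, hz.2⟩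

lemma of_grade_le_two [GradeOrder ℕ P] (hxy : x ≤ y)
    (htwo : grade ℕ y ≤ grade ℕ x + 2) (hcard : grade ℕ y = grade ℕ x + #(atomsIn x y)) :
    IsBooleanInterval x y := by
  have hgrade : ∀ z ∈ Ioo x y, grade ℕ x < grade ℕ z ∧ grade ℕ z < grade ℕ y := fun z hz =>
    ⟨grade_strictMono (mem_Ioo.1 hz).1, grade_strictMono (mem_Ioo.1 hz).2⟩
  have hatom : ∀ z ∈ Ioo x y, x ⋖ z := fun z hz =>
    covBy_of_le_of_grade_eq_add_one (mem_Ioo.1 hz).1.le (by have := hgrade z hz; omega)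
  refine .of_Ioo hxy (fun z hz w _ hzw => ?_) (fun z hz he => ?_) fun S hS hS₀ => ?_
  · exact (mem_atomsIn.1 (hzw (mem_atomsIn.2 ⟨hatom z hz, le_rfl⟩))).2
  · rw [← he, atomsIn_eq_singleton (hatom z hz), card_singleton] at hcard
    have := hgrade z hz
    omega
  · have hSone : #S = 1 := by
      have := card_lt_card hS
      have := hS₀.card_pos
      omega
    obtain ⟨a, rfl⟩ := card_eq_one.1 hSone
    obtain ⟨hxa, hay⟩ := mem_atomsIn.1 (hS.subset (mem_singleton_self a))
    refine ⟨a, mem_Ioo.2 ⟨hxa.lt, lt_of_le_of_ne hay ?_⟩, atomsIn_eq_singleton hxa⟩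
    rintro rfl
    exact hS.ne (atomsIn_eq_singleton hxa).symm

variable (h : IsBooleanInterval x y)
include h

protected lemma le : x ≤ y := by
  obtain ⟨z, hz, -⟩ := h.exists_atomsIn_eq ∅ (empty_subset _)
  exact (mem_Icc.1 hz).1.trans (mem_Icc.1 hz).2

lemma eq_of_atomsIn_eq (hz : z ∈ Icc x y) (hw : w ∈ Icc x y) (hzw : atomsIn x z = atomsIn x w) :
    z = w :=
  (h.le_of_atomsIn_subset z hz w hw hzw.subset).antisymm
    (h.le_of_atomsIn_subset w hw z hz hzw.superset)

lemma of_mem_Icc (hz : z ∈ Icc x y) : IsBooleanInterval x z where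
  le_of_atomsIn_subset u hu v hv :=
    h.le_of_atomsIn_subset u (Icc_subset_Icc_right (mem_Icc.1 hz).2 hu)
      v (Icc_subset_Icc_right (mem_Icc.1 hz).2 hv)
  exists_atomsIn_eq S hS := by
    obtain ⟨w, hw, rfl⟩ := h.exists_atomsIn_eq S (hS.trans (atomsIn_mono (mem_Icc.1 hz).2))
    exact ⟨w, mem_Icc.2 ⟨(mem_Icc.1 hw).1, h.le_of_atomsIn_subset w hw z hz hS⟩, rfl⟩

lemma card_atomsIn_lt_card_atomsIn (hz : z ∈ Icc x y) (hw : w ∈ Icc x y) (hzw : z < w) :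
    #(atomsIn x z) < #(atomsIn x w) :=
  card_lt_card ((atomsIn_mono hzw.le).ssubset_of_ne fun he => hzw.ne (h.eq_of_atomsIn_eq hz hw he))

lemma covBy_of_card_atomsIn_eq_add_one (hz : z ∈ Icc x y) (hw : w ∈ Icc x y) (hzw : z ≤ w)
    (hcard : #(atomsIn x w) = #(atomsIn x z) + 1) : z ⋖ w := by
  refine ⟨lt_of_le_of_ne hzw (by rintro rfl; omega), fun u hzu huw => ?_⟩
  have hu : u ∈ Icc x y :=
    mem_Icc.2 ⟨(mem_Icc.1 hz).1.trans hzu.le, huw.le.trans (mem_Icc.1 hw).2⟩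
  have hzu' := h.card_atomsIn_lt_card_atomsIn hz hu hzu
  have huw' := h.card_atomsIn_lt_card_atomsIn hu hw huw
  omega

variable [GradeOrder ℕ P]

lemma grade_eq_add_card : grade ℕ y = grade ℕ x + #(atomsIn x y) := by
  suffices ∀ S ⊆ atomsIn x y, ∀ z ∈ Icc x y, atomsIn x z = S → grade ℕ z = grade ℕ x + #S from
    this _ Subset.rfl y (right_mem_Icc.2 h.le) rfl
  intro S
  induction S using Finset.cons_induction with
  | empty =>
    intro _ z hz hzS
    rw [h.eq_of_atomsIn_eq hz (left_mem_Icc.2 h.le) (hzS.trans (atomsIn_self x).symm), card_empty,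
      add_zero]
  | cons a S haS ih =>
    intro hS w hw hwS
    obtain ⟨z, hz, hzS⟩ := h.exists_atomsIn_eq S ((subset_cons haS).trans hS)
    have hzw : z ≤ w :=
      h.le_of_atomsIn_subset z hz w hw (by rw [hzS, hwS]; exact subset_cons haS)
    rw [grade_of_covBy (h.covBy_of_card_atomsIn_eq_add_one hz hw hzw
      (by rw [hzS, hwS, card_cons])), ih ((subset_cons haS).trans hS) z hz hzS, card_cons,
      add_assoc]

lemma exists_common_covBy (ha : a ∈ atomsIn x y) (hb : b ∈ atomsIn x y) (hab : a ≠ b) :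
    ∃ p ≤ y, a ⋖ p ∧ b ⋖ p := by
  classical
  obtain ⟨p, hp, hpab⟩ :=
    h.exists_atomsIn_eq {a, b} (insert_subset ha (singleton_subset_iff.2 hb))
  have hgrade := (h.of_mem_Icc hp).grade_eq_add_card
  rw [hpab, card_pair hab] at hgrade
  have hcov : ∀ c ∈ ({a, b} : Finset P), c ⋖ p := fun c hc => by
    rw [← hpab, mem_atomsIn] at hc
    exact covBy_of_le_of_grade_eq_add_one hc.2 (by rw [hgrade, grade_of_covBy hc.1])
  exact ⟨p, (mem_Icc.1 hp).2, hcov a (mem_insert_self a _),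
    hcov b (mem_insert_of_mem (mem_singleton_self b))⟩

end IsBooleanInterval

end BooleanIntervals

section LocallyBooleanIntervals

/-- Two elements are linked below `y` if they have a common upper bound strictly below `y`. In a sum
of boolean lattices with top element `y`, two atoms are linked iff they lie in the same summand. -/
def Linked {P : Type*} [Preorder P] (y a b : P) : Prop := ∃ z < y, a ≤ z ∧ b ≤ z

lemma Linked.symm {P : Type*} [Preorder P] {y a b : P} : Linked y a b → Linked y b a :=
  fun ⟨z, hzy, haz, hbz⟩ => ⟨z, hzy, hbz, haz⟩

variable {P : Type*} [PartialOrder P] [LocallyFiniteOrder P]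
  {x y z w a b c p q : P} {k : ℕ} {S : Finset P}

open scoped Classical in
/-- The atoms of the summand of `[x, y]` that contains the atom `a`. -/
noncomputable def component (x y a : P) : Finset P := {b ∈ atomsIn x y | Linked y a b}

lemma mem_component : b ∈ component x y a ↔ b ∈ atomsIn x y ∧ Linked y a b := by
  simp only [component, mem_filter]

lemma component_subset (x y a : P) : component x y a ⊆ atomsIn x y :=
  fun _ hb => (mem_component.1 hb).1

lemma atomsIn_subset_component (hzy : z < y) (ha : a ∈ atomsIn x z) :
    atomsIn x z ⊆ component x y a := fun _ hb =>
  mem_component.2 ⟨atomsIn_mono hzy.le hb, z, hzy, (mem_atomsIn.1 ha).2, (mem_atomsIn.1 hb).2⟩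

variable [GradeOrder ℕ P]

lemma covBy_of_mem_atomsIn (hxa : x ⋖ a) (hap : a ⋖ p) (hb : b ∈ atomsIn x p) : b ⋖ p := by
  obtain ⟨hxb, hbp⟩ := mem_atomsIn.1 hb
  exact covBy_of_le_of_grade_eq_add_one hbp
    (by rw [grade_of_covBy hap, grade_of_covBy hxa, grade_of_covBy hxb])

/-- The interval `[x, y]` has rank `k ≥ 3`, and its proper lower intervals `[x, z]` and the upper
intervals `[a, y]` starting in its atoms are boolean lattices. In rank `3` these conditions allow
polygons with any number of sides, and the triangle is singled out by its number of atoms. -/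
structure IsLocallyBoolean (x y : P) (k : ℕ) : Prop where
  three_le : 3 ≤ k
  le : x ≤ y
  grade_eq : grade ℕ y = grade ℕ x + k
  lower : ∀ z ∈ Ico x y, IsBooleanInterval x z
  upper : ∀ a ∈ atomsIn x y, IsBooleanInterval a y
  card_of_eq_three : k = 3 → #(atomsIn x y) = 3

namespace IsLocallyBoolean

variable (h : IsLocallyBoolean x y k)
include h

lemma lt_of_grade_eq {i : ℕ} (hzy : z ≤ y) (hz : grade ℕ z = grade ℕ x + i) (hi : i < k) :
    z < y :=
  lt_of_le_of_ne hzy <| by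
    rintro rfl
    have := h.grade_eq
    omega

lemma lt_of_mem_atomsIn (ha : a ∈ atomsIn x y) : a < y :=
  h.lt_of_grade_eq (mem_atomsIn.1 ha).2 (grade_of_covBy (mem_atomsIn.1 ha).1)
    (by have := h.three_le; omega)

lemma lt_of_covBy_covBy (hxa : x ⋖ a) (hap : a ⋖ p) (hpy : p ≤ y) : p < y :=
  h.lt_of_grade_eq hpy (by rw [grade_of_covBy hap, grade_of_covBy hxa, add_assoc])
    (by have := h.three_le; omega)

lemma card_atomsIn_of_covBy_covBy (hxa : x ⋖ a) (hap : a ⋖ p) (hpy : p ≤ y) :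
    #(atomsIn x p) = 2 := by
  have hp := (h.lower p (mem_Ico.2
    ⟨hxa.le.trans hap.le, h.lt_of_covBy_covBy hxa hap hpy⟩)).grade_eq_add_card
  rw [grade_of_covBy hap, grade_of_covBy hxa] at hp
  omega

lemma card_atomsIn_upper (ha : a ∈ atomsIn x y) : #(atomsIn a y) + 1 = k := by
  have hy := (h.upper a ha).grade_eq_add_card
  rw [h.grade_eq, grade_of_covBy (mem_atomsIn.1 ha).1] at hy
  omega

lemma atomsIn_eq_pair [DecidableEq P] (hxa : x ⋖ a) (hxb : x ⋖ b) (hab : a ≠ b) (hap : a ⋖ p)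
    (hbp : b ≤ p) (hpy : p ≤ y) : atomsIn x p = {a, b} := by
  refine (eq_of_subset_of_card_le ?_ ?_).symm
  · exact insert_subset (mem_atomsIn.2 ⟨hxa, hap.le⟩)
      (singleton_subset_iff.2 (mem_atomsIn.2 ⟨hxb, hbp⟩))
  · rw [h.card_atomsIn_of_covBy_covBy hxa hap hpy, card_pair hab]

lemma exists_lt_common_covBy (hk : 4 ≤ k) (ha : a ∈ atomsIn x y) (hp : p ∈ atomsIn a y)
    (hq : q ∈ atomsIn a y) (hpq : p ≠ q) : ∃ r < y, p ⋖ r ∧ q ⋖ r := by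
  obtain ⟨r, hry, hpr, hqr⟩ := (h.upper a ha).exists_common_covBy hp hq hpq
  refine ⟨r, h.lt_of_grade_eq (i := 3) hry ?_ hk, hpr, hqr⟩
  rw [grade_of_covBy hpr, grade_of_covBy (mem_atomsIn.1 hp).1, grade_of_covBy (mem_atomsIn.1 ha).1]

lemma exists_mem_atomsIn_ne (hxa : x ⋖ a) (hap : a ⋖ p) (hpy : p ≤ y) :
    ∃ b ∈ atomsIn x p, b ≠ a :=
  exists_mem_ne (by rw [h.card_atomsIn_of_covBy_covBy hxa hap hpy]; exact one_lt_two) a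

lemma atomsIn_eq_pair_of_eq_three [DecidableEq P] (hk : k = 3) (hxa : x ⋖ a) (hap : a ⋖ p)
    (hpy : p ≤ y) (haq : a ⋖ q) (hqy : q ≤ y) (hpq : p ≠ q) : atomsIn a y = {p, q} := by
  refine (eq_of_subset_of_card_le ?_ ?_).symm
  · exact insert_subset (mem_atomsIn.2 ⟨hap, hpy⟩)
      (singleton_subset_iff.2 (mem_atomsIn.2 ⟨haq, hqy⟩))
  · have := h.card_atomsIn_upper (mem_atomsIn.2 ⟨hxa, hap.le.trans hpy⟩)
    rw [card_pair hpq]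
    omega

/-- If `p ≠ q` both covered `a` and `b` in rank three, then every cover of the third atom, lying
above `a` or `b` too, would have to be `p` or `q`. -/
lemma common_covBy_unique_of_eq_three (hk : k = 3) (hxa : x ⋖ a) (hxb : x ⋖ b) (hab : a ≠ b)
    (hap : a ⋖ p) (hbp : b ⋖ p) (hpy : p ≤ y) (haq : a ⋖ q) (hbq : b ⋖ q) (hqy : q ≤ y) :
    p = q := by
  classical
  by_contra hpq
  have hsub : {a, b} ⊆ atomsIn x y := insert_subset (mem_atomsIn.2 ⟨hxa, hap.le.trans hpy⟩)
    (singleton_subset_iff.2 (mem_atomsIn.2 ⟨hxb, hbp.le.trans hpy⟩))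
  obtain ⟨c, hc⟩ := card_eq_one.1 (show #(atomsIn x y \ {a, b}) = 1 by
    rw [card_sdiff_of_subset hsub, h.card_of_eq_three hk, card_pair hab])
  obtain ⟨hcy, hcab⟩ := mem_sdiff.1 (hc ▸ mem_singleton_self c)
  obtain ⟨r, hcr, hry⟩ := exists_covBy_le_of_lt (h.lt_of_mem_atomsIn hcy)
  obtain ⟨d, hd, hdc⟩ := h.exists_mem_atomsIn_ne (mem_atomsIn.1 hcy).1 hcr hry
  have hdr : d ⋖ r := covBy_of_mem_atomsIn (mem_atomsIn.1 hcy).1 hcr hd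
  have hdab : d = a ∨ d = b := by
    by_contra hdab
    refine hdc (mem_singleton.1 (hc ▸ mem_sdiff.2 ⟨atomsIn_mono hry hd, ?_⟩))
    rwa [mem_insert, mem_singleton]
  have hrpq : r = p ∨ r = q := by
    have hrd : r ∈ atomsIn d y := mem_atomsIn.2 ⟨hdr, hry⟩
    rcases hdab with rfl | rfl
    · rwa [h.atomsIn_eq_pair_of_eq_three hk hxa hap hpy haq hqy hpq, mem_insert,
        mem_singleton] at hrd
    · rwa [h.atomsIn_eq_pair_of_eq_three hk hxb hbp hpy hbq hqy hpq, mem_insert,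
        mem_singleton] at hrd
  have hcr' : c ∈ atomsIn x r := mem_atomsIn.2 ⟨(mem_atomsIn.1 hcy).1, hcr.le⟩
  rcases hrpq with rfl | rfl
  · exact hcab (h.atomsIn_eq_pair hxa hxb hab hap hbp.le hpy ▸ hcr')
  · exact hcab (h.atomsIn_eq_pair hxa hxb hab haq hbq.le hqy ▸ hcr')

lemma common_covBy_unique (hxa : x ⋖ a) (hxb : x ⋖ b) (hab : a ≠ b)
    (hap : a ⋖ p) (hbp : b ⋖ p) (hpy : p ≤ y) (haq : a ⋖ q) (hbq : b ⋖ q) (hqy : q ≤ y) :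
    p = q := by
  classical
  rcases h.three_le.eq_or_lt with hk | hk
  · exact h.common_covBy_unique_of_eq_three hk.symm hxa hxb hab hap hbp hpy haq hbq hqy
  by_contra hpq
  obtain ⟨r, hry, hpr, hqr⟩ := h.exists_lt_common_covBy hk
    (mem_atomsIn.2 ⟨hxa, hap.le.trans hpy⟩) (mem_atomsIn.2 ⟨hap, hpy⟩) (mem_atomsIn.2 ⟨haq, hqy⟩)
    hpq
  refine hpq ((h.lower r (mem_Ico.2 ⟨hxa.le.trans (hap.le.trans hpr.le), hry⟩)).eq_of_atomsIn_eq
    (mem_Icc.2 ⟨hxa.le.trans hap.le, hpr.le⟩) (mem_Icc.2 ⟨hxa.le.trans haq.le, hqr.le⟩) ?_)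
  rw [h.atomsIn_eq_pair hxa hxb hab hap hbp.le hpy, h.atomsIn_eq_pair hxa hxb hab haq hbq.le hqy]

lemma exists_common_covBy_le (hzy : z < y) (ha : a ∈ atomsIn x z) (hb : b ∈ atomsIn x z)
    (hab : a ≠ b) : ∃ p ≤ z, a ⋖ p ∧ b ⋖ p :=
  (h.lower z (mem_Ico.2 ⟨(mem_atomsIn.1 ha).1.le.trans (mem_atomsIn.1 ha).2,
    hzy⟩)).exists_common_covBy ha hb hab

lemma exists_common_covBy_of_linked (hxa : x ⋖ a) (hxb : x ⋖ b) (hab : a ≠ b)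
    (hlink : Linked y a b) : ∃ p ≤ y, a ⋖ p ∧ b ⋖ p := by
  obtain ⟨z, hzy, haz, hbz⟩ := hlink
  obtain ⟨p, hpz, hp⟩ := h.exists_common_covBy_le hzy (mem_atomsIn.2 ⟨hxa, haz⟩)
    (mem_atomsIn.2 ⟨hxb, hbz⟩) hab
  exact ⟨p, hpz.trans hzy.le, hp⟩

lemma mem_component_self (ha : a ∈ atomsIn x y) : a ∈ component x y a :=
  mem_component.2 ⟨ha, a, h.lt_of_mem_atomsIn ha, le_rfl, le_rfl⟩

lemma erase_component_eq_biUnion [DecidableEq P] (ha : a ∈ atomsIn x y) :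
    (component x y a).erase a = (atomsIn a y).biUnion fun p => (atomsIn x p).erase a := by
  have hxa := (mem_atomsIn.1 ha).1
  ext b
  simp only [mem_erase, mem_biUnion]
  constructor
  · rintro ⟨hba, hb⟩
    obtain ⟨hb, hlink⟩ := mem_component.1 hb
    have hxb := (mem_atomsIn.1 hb).1
    obtain ⟨p, hpy, hap, hbp⟩ := h.exists_common_covBy_of_linked hxa hxb hba.symm hlink
    exact ⟨p, mem_atomsIn.2 ⟨hap, hpy⟩, hba, mem_atomsIn.2 ⟨hxb, hbp.le⟩⟩
  · rintro ⟨p, hp, hba, hb⟩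
    obtain ⟨hap, hpy⟩ := mem_atomsIn.1 hp
    exact ⟨hba, atomsIn_subset_component (h.lt_of_covBy_covBy hxa hap hpy)
      (mem_atomsIn.2 ⟨hxa, hap.le⟩) hb⟩

lemma card_component (ha : a ∈ atomsIn x y) : #(component x y a) = k := by
  classical
  have hxa := (mem_atomsIn.1 ha).1
  have hdisj : (atomsIn a y : Set P).PairwiseDisjoint fun p => (atomsIn x p).erase a := by
    refine fun p hp q hq hpq => disjoint_left.2 fun b hbp hbq => hpq ?_
    obtain ⟨hap, hpy⟩ := mem_atomsIn.1 hp
    obtain ⟨haq, hqy⟩ := mem_atomsIn.1 hq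
    obtain ⟨hba, hbp⟩ := mem_erase.1 hbp
    exact h.common_covBy_unique hxa (mem_atomsIn.1 hbp).1 hba.symm hap
      (covBy_of_mem_atomsIn hxa hap hbp) hpy haq
      (covBy_of_mem_atomsIn hxa haq (mem_erase.1 hbq).2) hqy
  have hone : ∀ p ∈ atomsIn a y, #((atomsIn x p).erase a) = 1 := fun p hp => by
    obtain ⟨hap, hpy⟩ := mem_atomsIn.1 hp
    rw [card_erase_of_mem (mem_atomsIn.2 ⟨hxa, hap.le⟩),
      h.card_atomsIn_of_covBy_covBy hxa hap hpy]
  rw [← card_erase_add_one (h.mem_component_self ha), h.erase_component_eq_biUnion ha,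
    card_biUnion hdisj, sum_congr rfl hone, sum_const, smul_eq_mul, mul_one,
    h.card_atomsIn_upper ha]

lemma linked_trans (ha : a ∈ atomsIn x y) (hb : b ∈ atomsIn x y) (hc : c ∈ atomsIn x y)
    (hab : Linked y a b) (hbc : Linked y b c) : Linked y a c := by
  rcases h.three_le.eq_or_lt with hk | hk
  · have hall : component x y a = atomsIn x y := eq_of_subset_of_card_le (component_subset x y a)
      (by rw [h.card_component ha, h.card_of_eq_three hk.symm, ← hk])
    exact (mem_component.1 (hall.symm ▸ hc)).2
  rcases eq_or_ne a b with rfl | hab'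
  · exact hbc
  rcases eq_or_ne b c with rfl | hbc'
  · exact hab
  obtain ⟨hxa, -⟩ := mem_atomsIn.1 ha
  obtain ⟨hxb, -⟩ := mem_atomsIn.1 hb
  obtain ⟨hxc, -⟩ := mem_atomsIn.1 hc
  obtain ⟨p, hpy, hap, hbp⟩ := h.exists_common_covBy_of_linked hxa hxb hab' hab
  obtain ⟨q, hqy, hbq, hcq⟩ := h.exists_common_covBy_of_linked hxb hxc hbc' hbc
  rcases eq_or_ne p q with rfl | hpq
  · exact ⟨p, h.lt_of_covBy_covBy hxa hap hpy, hap.le, hcq.le⟩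
  · obtain ⟨r, hry, hpr, hqr⟩ := h.exists_lt_common_covBy hk hb (mem_atomsIn.2 ⟨hbp, hpy⟩)
      (mem_atomsIn.2 ⟨hbq, hqy⟩) hpq
    exact ⟨r, hry, hap.le.trans hpr.le, hcq.le.trans hqr.le⟩

lemma component_eq_of_mem (ha : a ∈ atomsIn x y) (hb : b ∈ component x y a) :
    component x y b = component x y a := by
  obtain ⟨hb, hab⟩ := mem_component.1 hb
  ext c
  simp only [mem_component, and_congr_right_iff]
  exact fun hc => ⟨h.linked_trans ha hb hc hab, h.linked_trans hb ha hc hab.symm⟩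

lemma le_of_atomsIn_subset (hz : z ∈ Ioo x y) (hw : w ∈ Ioo x y)
    (hzw : atomsIn x z ⊆ atomsIn x w) : z ≤ w := by
  obtain ⟨hxz, hzy⟩ := mem_Ioo.1 hz
  obtain ⟨-, hwy⟩ := mem_Ioo.1 hw
  obtain ⟨a, ha⟩ := atomsIn_nonempty hxz
  obtain ⟨hxa, haz⟩ := mem_atomsIn.1 ha
  have haw := (mem_atomsIn.1 (hzw ha)).2
  refine (h.upper a (atomsIn_mono hzy.le ha)).le_of_atomsIn_subset z
    (mem_Icc.2 ⟨haz, hzy.le⟩) w (mem_Icc.2 ⟨haw, hwy.le⟩) fun p hp => ?_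
  obtain ⟨hap, hpz⟩ := mem_atomsIn.1 hp
  obtain ⟨b, hb, hba⟩ := h.exists_mem_atomsIn_ne hxa hap (hpz.trans hzy.le)
  obtain ⟨q, hqw, haq, hbq⟩ :=
    h.exists_common_covBy_le hwy (hzw ha) (hzw (atomsIn_mono hpz hb)) hba.symm
  obtain rfl : p = q := h.common_covBy_unique hxa (mem_atomsIn.1 hb).1 hba.symm hap
    (covBy_of_mem_atomsIn hxa hap hb) (hpz.trans hzy.le) haq hbq (hqw.trans hwy.le)
  exact mem_atomsIn.2 ⟨haq, hqw⟩

lemma exists_atomsIn_eq_pair [DecidableEq P] (ha : a ∈ atomsIn x y) (hb : b ∈ component x y a)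
    (hba : b ≠ a) : ∃ p ∈ atomsIn a y, atomsIn x p = {a, b} := by
  obtain ⟨hb, hlink⟩ := mem_component.1 hb
  have hxa := (mem_atomsIn.1 ha).1
  have hxb := (mem_atomsIn.1 hb).1
  obtain ⟨p, hpy, hap, hbp⟩ := h.exists_common_covBy_of_linked hxa hxb hba.symm hlink
  exact ⟨p, mem_atomsIn.2 ⟨hap, hpy⟩, h.atomsIn_eq_pair hxa hxb hba.symm hap hbp.le hpy⟩

/-- In the boolean lattice `[a, y]` take the join of the atoms `p` whose lower atoms, `a` and one
other, lie in `S`. -/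
lemma exists_atomsIn_eq_of_mem (ha : a ∈ S) (hS : S ⊂ component x y a) :
    ∃ z ∈ Ioo x y, atomsIn x z = S := by
  classical
  have hay := (mem_component.1 (hS.subset ha)).1
  have hxa := (mem_atomsIn.1 hay).1
  obtain ⟨z, hz, hzS⟩ := (h.upper a hay).exists_atomsIn_eq {p ∈ atomsIn a y | atomsIn x p ⊆ S}
    (filter_subset _ _)
  obtain ⟨haz, hzy⟩ := mem_Icc.1 hz
  have hmem : ∀ {p}, p ∈ atomsIn a z ↔ p ∈ atomsIn a y ∧ atomsIn x p ⊆ S := by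
    rw [hzS]
    exact mem_filter
  have hzy : z < y := lt_of_le_of_ne hzy <| by
    rintro rfl
    obtain ⟨b, hb, hbS⟩ := exists_of_ssubset hS
    obtain ⟨p, hp, hpab⟩ := h.exists_atomsIn_eq_pair hay hb fun hba => hbS (hba ▸ ha)
    exact hbS ((hmem.1 hp).2 (hpab ▸ mem_insert_of_mem (mem_singleton_self b)))
  refine ⟨z, mem_Ioo.2 ⟨hxa.lt.trans_le haz, hzy⟩, Subset.antisymm (fun b hb => ?_) fun b hb => ?_⟩
  · rcases eq_or_ne b a with rfl | hba
    · exact ha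
    obtain ⟨p, hpz, hap, hbp⟩ :=
      h.exists_common_covBy_le hzy (mem_atomsIn.2 ⟨hxa, haz⟩) hb hba.symm
    exact (hmem.1 (mem_atomsIn.2 ⟨hap, hpz⟩)).2 (mem_atomsIn.2 ⟨(mem_atomsIn.1 hb).1, hbp.le⟩)
  · refine mem_atomsIn.2 ⟨(mem_atomsIn.1 (mem_component.1 (hS.subset hb)).1).1, ?_⟩
    rcases eq_or_ne b a with rfl | hba
    · exact haz
    obtain ⟨p, hp, hpab⟩ := h.exists_atomsIn_eq_pair hay (hS.subset hb) hba
    have hpz : p ∈ atomsIn a z :=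
      hmem.2 ⟨hp, hpab ▸ insert_subset ha (singleton_subset_iff.2 hb)⟩
    have hbp : b ∈ atomsIn x p := hpab ▸ mem_insert_of_mem (mem_singleton_self b)
    exact (mem_atomsIn.1 hbp).2.trans (mem_atomsIn.1 hpz).2

lemma card_atomsIn_lt (hz : z ∈ Ico x y) : #(atomsIn x z) < k := by
  have hcard := (h.lower z hz).grade_eq_add_card
  have hlt := grade_strictMono (𝕆 := ℕ) (mem_Ico.1 hz).2
  rw [hcard, h.grade_eq] at hlt
  exact Nat.lt_of_add_lt_add_left hlt

lemma atomsIn_ssubset_component (hz : z ∈ Ico x y) (ha : a ∈ atomsIn x z) :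
    atomsIn x z ⊂ component x y a := by
  have hzy := (mem_Ico.1 hz).2
  refine ssubset_of_subset_of_ne (atomsIn_subset_component hzy ha) fun hzc => ?_
  exact (h.card_atomsIn_lt hz).ne (hzc ▸ h.card_component (atomsIn_mono hzy.le ha))

lemma isBooleanInterval_of_card_atomsIn_eq (hcard : #(atomsIn x y) = k) :
    IsBooleanInterval x y := by
  have hcomp : ∀ a ∈ atomsIn x y, component x y a = atomsIn x y := fun a ha =>
    eq_of_subset_of_card_le (component_subset x y a) (by rw [hcard, h.card_component ha])
  refine .of_Ioo h.le (fun z hz w hw => h.le_of_atomsIn_subset hz hw) (fun z hz hzy => ?_)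
    fun S hS hne => ?_
  · obtain ⟨hxz, hzy'⟩ := mem_Ioo.1 hz
    exact (h.card_atomsIn_lt (mem_Ico.2 ⟨hxz.le, hzy'⟩)).ne (hzy ▸ hcard)
  · obtain ⟨a, ha⟩ := hne
    exact h.exists_atomsIn_eq_of_mem ha (by rwa [hcomp a (hS.subset ha)])

end IsLocallyBoolean

end LocallyBooleanIntervals

section SumsOfBooleanLattices

lemma exists_map_univ_eq {P : Type*} {C : Finset P} {k : ℕ} (hC : #C = k) :
    ∃ e : Fin k ↪ P, univ.map e = C := by
  refine ⟨(equivFinOfCardEq hC).symm.toEmbedding.trans (.subtype _), ?_⟩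
  rw [← map_map, map_univ_equiv, univ_eq_attach, attach_map_val]

lemma map_subset_map_iff_sigma_le {P ι κ : Type*} [Fintype κ] {e : ι → κ ↪ P}
    (he : Pairwise fun i j => Disjoint (univ.map (e i)) (univ.map (e j)))
    (p q : Σ _ : ι, Set.Ioo (⊥ : Finset κ) ⊤) :
    (p.2 : Finset κ).map (e p.1) ⊆ (q.2 : Finset κ).map (e q.1) ↔ p ≤ q := by
  obtain ⟨i, S, hS⟩ := p
  obtain ⟨j, T, hT⟩ := q
  refine ⟨fun hST => ?_, fun ⟨_, _, _, hST⟩ => map_subset_map.2 hST⟩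
  obtain rfl : i = j := by
    by_contra hij
    obtain ⟨s, hs⟩ := nonempty_iff_ne_empty.2 hS.1.ne'
    exact disjoint_left.1 (he hij) (mem_map_of_mem _ (mem_univ s))
      (map_subset_map.2 (subset_univ T) (hST (mem_map_of_mem _ hs)))
  exact Sigma.LE.fiber i _ _ (map_subset_map.1 hST)

variable {P : Type*} [PartialOrder P] [LocallyFiniteOrder P] {x y a : P} {k : ℕ} {C : Finset P}

open scoped Classical in
/-- The sets of atoms of the summands of `[x, y]`. -/
noncomputable def components (x y : P) : Finset (Finset P) :=
  (atomsIn x y).image (component x y)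

lemma mem_components : C ∈ components x y ↔ ∃ a ∈ atomsIn x y, component x y a = C := by
  classical exact mem_image

namespace IsLocallyBoolean

variable [GradeOrder ℕ P] (h : IsLocallyBoolean x y k)
include h

lemma component_eq_of_mem_components (hC : C ∈ components x y) (ha : a ∈ C) :
    component x y a = C := by
  obtain ⟨b, hb, rfl⟩ := mem_components.1 hC
  exact h.component_eq_of_mem hb ha

lemma card_of_mem_components (hC : C ∈ components x y) : #C = k := by
  obtain ⟨b, hb, rfl⟩ := mem_components.1 hC
  exact h.card_component hb

lemma filter_component_eq [DecidableEq P] (hC : C ∈ components x y) :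
    {a ∈ atomsIn x y | component x y a = C} = C := by
  ext a
  refine mem_filter.trans ⟨fun ⟨ha, haC⟩ => haC ▸ h.mem_component_self ha, fun ha => ?_⟩
  have haC := h.component_eq_of_mem_components hC ha
  exact ⟨component_subset x y a (haC ▸ ha), haC⟩

lemma card_components_mul : #(components x y) * k = #(atomsIn x y) := by
  classical
  rw [card_eq_sum_card_image (component x y) (atomsIn x y), components]
  refine (sum_const_nat fun C hC => ?_).symm
  rw [h.filter_component_eq hC, h.card_of_mem_components hC]

lemma exists_embeddings :
    ∃ e : Fin #(components x y) → Fin k ↪ P,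
      (∀ a ∈ atomsIn x y, ∃ i, univ.map (e i) = component x y a) ∧
      (∀ i s, component x y (e i s) = univ.map (e i)) ∧
      Pairwise fun i j => Disjoint (univ.map (e i)) (univ.map (e j)) := by
  let C : Fin #(components x y) ≃ components x y := (components x y).equivFin.symm
  choose e he using fun i => exists_map_univ_eq (h.card_of_mem_components (C i).2)
  refine ⟨e, fun a ha => ?_, fun i s => ?_, fun i j hij => ?_⟩
  · refine ⟨C.symm ⟨_, mem_components.2 ⟨a, ha, rfl⟩⟩, ?_⟩
    rw [he, Equiv.apply_symm_apply]
  · rw [he]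
    exact h.component_eq_of_mem_components (C i).2 (he i ▸ mem_map_of_mem _ (mem_univ s))
  · simp only [he]
    refine disjoint_left.2 fun a hai haj => hij (C.injective (Subtype.ext ?_))
    rw [← h.component_eq_of_mem_components (C i).2 hai,
      h.component_eq_of_mem_components (C j).2 haj]

theorem nonempty_orderIso_Ioo :
    Nonempty ((Σ _ : Fin #(components x y), Set.Ioo (⊥ : Finset (Fin k)) ⊤) ≃o Set.Ioo x y) := by
  obtain ⟨e, hcover, hcomp, hdisj⟩ := h.exists_embeddings
  have hex : ∀ p : Σ _ : Fin #(components x y), Set.Ioo (⊥ : Finset (Fin k)) ⊤,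
      ∃ z : Set.Ioo x y, atomsIn x (z : P) = (p.2 : Finset (Fin k)).map (e p.1) := by
    rintro ⟨i, S, hS⟩
    obtain ⟨s, hs⟩ := nonempty_iff_ne_empty.2 hS.1.ne'
    obtain ⟨z, hz, hzS⟩ := h.exists_atomsIn_eq_of_mem (mem_map_of_mem (e i) hs)
      (hcomp i s ▸ map_ssubset_map.2 hS.2)
    exact ⟨⟨z, mem_Ioo.1 hz⟩, hzS⟩
  have hle (z w : Set.Ioo x y) : atomsIn x (z : P) ⊆ atomsIn x w ↔ z ≤ w :=
    ⟨h.le_of_atomsIn_subset (mem_Ioo.2 z.2) (mem_Ioo.2 w.2), fun hzw => atomsIn_mono hzw⟩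
  choose g hg using hex
  refine ⟨.ofSurjective (.ofMapLEIff g fun p q => ?_) fun z => ?_⟩
  · rw [← hle, hg, hg, map_subset_map_iff_sigma_le hdisj]
  · obtain ⟨a, ha⟩ := atomsIn_nonempty z.2.1
    obtain ⟨i, hi⟩ := hcover a (atomsIn_mono z.2.2.le ha)
    have hzi := h.atomsIn_ssubset_component (mem_Ico.2 ⟨z.2.1.le, z.2.2⟩) ha
    obtain ⟨S, -, hS⟩ := subset_map_iff.1 (hi ▸ hzi.subset)
    have hS₀ : S ∈ Set.Ioo (⊥ : Finset (Fin k)) ⊤ := by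
      refine ⟨bot_lt_iff_ne_bot.2 ?_, lt_top_iff_ne_top.2 ?_⟩
      · rintro rfl
        exact (atomsIn_nonempty z.2.1).ne_empty hS
      · rintro rfl
        exact hzi.ne (hS.trans hi)
    have hgz : atomsIn x (g ⟨i, S, hS₀⟩ : P) = atomsIn x z := by rw [hg, hS]
    exact ⟨⟨i, S, hS₀⟩, le_antisymm ((hle _ _).1 hgz.le) ((hle _ _).1 hgz.ge)⟩

end IsLocallyBoolean

end SumsOfBooleanLattices

section AlternatingSums

lemma sum_sub_sum_eq_of_eqOn_sdiff {ι M : Type*} [AddCommGroup M] {s t : Finset ι} {f g : ι → M}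
    (hst : s ⊆ t) (h : ∀ i ∈ t, i ∉ s → f i = g i) :
    ∑ i ∈ t, f i - ∑ i ∈ t, g i = ∑ i ∈ s, (f i - g i) := by
  rw [← sum_sub_distrib]
  exact (sum_subset hst fun i hi his => sub_eq_zero.2 (h i hi his)).symm

lemma sum_neg_one_pow_div_factorial {k : ℕ} (hk : k ≠ 0) :
    ∑ i ∈ range (k + 1), (-1 : ℚ) ^ i / (i ! * (k - i)!) = 0 := by
  have hchoose : ∑ i ∈ range (k + 1), (-1 : ℚ) ^ i * k.choose i = 0 := by
    exact_mod_cast Int.alternating_sum_range_choose_of_ne hk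
  rw [← zero_div (k ! : ℚ), ← hchoose, sum_div]
  refine sum_congr rfl fun i hi => ?_
  rw [Nat.cast_choose ℚ (Nat.le_of_lt_succ (mem_range.1 hi))]
  field_simp

variable {B D : ℕ → ℕ} {k c : ℕ}

lemma eq_factorial_of_even (hk : Even k) (hk₀ : k ≠ 0) (hB : ∀ i < k, B i = i !)
    (hsum : ∑ i ∈ range (k + 1), (-1 : ℚ) ^ i / (B i * B (k - i)) = 0) : B k = k ! := by
  have hends := sum_sub_sum_eq_of_eqOn_sdiff (s := {0, k}) (t := range (k + 1))
    (f := fun i => (-1 : ℚ) ^ i / (B i * B (k - i)))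
    (g := fun i => (-1 : ℚ) ^ i / (i ! * (k - i)!)) (fun i hi => by simp at hi ⊢; omega)
    fun i hi hi' => by
      simp only [mem_range, mem_insert, mem_singleton] at hi hi'
      rw [hB i (by omega), hB (k - i) (by omega)]
  rw [hsum, sum_neg_one_pow_div_factorial hk₀, sum_pair hk₀.symm] at hends
  simp only [hk.neg_one_pow, pow_zero, tsub_zero, tsub_self, hB 0 (Nat.pos_of_ne_zero hk₀),
    Nat.factorial_zero, Nat.cast_one, one_mul, mul_one] at hends
  have hinv : (B k : ℚ)⁻¹ = (k ! : ℚ)⁻¹ := by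
    rw [← one_div, ← one_div]
    linarith
  exact_mod_cast inv_injective hinv

lemma one_div_add_one_div_factorial_of_odd (hk : Odd k) (hk₂ : 2 ≤ k) (hB : ∀ i < k, B i = i !)
    (hsum : ∑ i ∈ range (k + 2), (-1 : ℚ) ^ i / (B i * B (k + 1 - i)) = 0) :
    (1 / B (k + 1) + 1 / k ! : ℚ) = 1 / B k + 1 / (k + 1)! := by
  have hends := sum_sub_sum_eq_of_eqOn_sdiff (s := {0, 1, k, k + 1}) (t := range (k + 2))
    (f := fun i => (-1 : ℚ) ^ i / (B i * B (k + 1 - i)))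
    (g := fun i => (-1 : ℚ) ^ i / (i ! * (k + 1 - i)!)) (fun i hi => by simp at hi ⊢; omega)
    fun i hi hi' => by
      simp only [mem_range, mem_insert, mem_singleton] at hi hi'
      rw [hB i (by omega), hB (k + 1 - i) (by omega)]
  rw [hsum, sum_neg_one_pow_div_factorial k.succ_ne_zero, sum_insert (by simp; omega),
    sum_insert (by simp; omega), sum_pair k.lt_add_one.ne] at hends
  simp only [hk.neg_one_pow, hk.add_one.neg_one_pow, pow_zero, pow_one, tsub_zero, tsub_self,
    add_tsub_cancel_right, add_tsub_cancel_left, hB 0 (by omega), hB 1 (by omega),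
    Nat.factorial_zero, Nat.factorial_one, Nat.cast_one, one_mul, mul_one, neg_div] at hends
  linarith

lemma eq_one_of_eq_mul_factorial_of_odd (hk : Odd k) (hk₂ : 2 ≤ k) (hB : ∀ i < k, B i = i !)
    (hBk : B k = c * k !) (hc : c ≠ 0) (hpos : 0 < B (k + 1))
    (hsum : ∑ i ∈ range (k + 2), (-1 : ℚ) ^ i / (B i * B (k + 1 - i)) = 0) : c = 1 := by
  by_contra hc₁
  have hrel := one_div_add_one_div_factorial_of_odd hk hk₂ hB hsum
  have hfac : (0 : ℚ) < 1 / k ! := by positivity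
  have hB' : (0 : ℚ) < 1 / B (k + 1) := by positivity
  have hBk' : (1 / B k : ℚ) = 1 / c * (1 / k !) := by
    rw [hBk, Nat.cast_mul, one_div_mul_one_div]
  have hsucc : (1 / (k + 1)! : ℚ) = 1 / (k + 1) * (1 / k !) := by
    rw [Nat.factorial_succ, one_div_mul_one_div]
    push_cast
    rfl
  have hc' : (1 / c : ℚ) ≤ 1 / 2 :=
    one_div_le_one_div_of_le two_pos (by exact_mod_cast (by omega : 2 ≤ c))
  have hk' : (1 / (k + 1) : ℚ) ≤ 1 / 2 :=
    one_div_le_one_div_of_le two_pos (by exact_mod_cast (by omega : 2 ≤ k + 1))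
  nlinarith

lemma eq_two_mul_of_odd (hk : Odd k) (hB : ∀ i < k, B i = i !) (hD₁ : D 1 = 1)
    (hD : ∀ i, i ≠ 0 → i < k → D (i + 1) = 2 * i !) (hBpos : 0 < B k) (hDpos : 0 < D (k + 1))
    (hsum : ∑ i ∈ range (k + 1), (-1 : ℚ) ^ i / (D (i + 1) * B (k - i)) = 1 / D (k + 1)) :
    D (k + 1) = 2 * B k := by
  have hends := sum_sub_sum_eq_of_eqOn_sdiff (s := {0, k}) (t := range (k + 1))
    (f := fun i => (-1 : ℚ) ^ i / (D (i + 1) * B (k - i)))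
    (g := fun i => 1 / 2 * ((-1 : ℚ) ^ i / (i ! * (k - i)!)))
    (fun i hi => by simp at hi ⊢; omega)
    fun i hi hi' => by
      simp only [mem_range, mem_insert, mem_singleton] at hi hi'
      rw [hD i (by omega) (by omega), hB (k - i) (by omega)]
      push_cast
      ring
  rw [hsum, ← mul_sum, sum_neg_one_pow_div_factorial hk.pos.ne', sum_pair hk.pos.ne] at hends
  simp only [hk.neg_one_pow, pow_zero, tsub_zero, tsub_self, zero_add, hD₁, hB 0 hk.pos,
    Nat.factorial_zero, Nat.cast_one, one_mul, mul_one, neg_div] at hends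
  have hrel : (2 / D (k + 1) : ℚ) = 1 / B k := by
    rw [← one_add_one_eq_two, add_div]
    linarith
  rw [div_eq_div_iff (by positivity) (by positivity), one_mul] at hrel
  exact_mod_cast hrel.symm

lemma two_div_add_one_div_two_mul_factorial_of_even (hk : Even k) (hk₀ : k ≠ 0)
    (hB : ∀ i ≤ k, B i = i !) (hD₁ : D 1 = 1)
    (hD : ∀ i, i ≠ 0 → i < k → D (i + 1) = 2 * i !)
    (hsum : ∑ i ∈ range (k + 2), (-1 : ℚ) ^ i / (D (i + 1) * B (k + 1 - i)) = 1 / D (k + 2)) :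
    (2 / D (k + 2) + 1 / (2 * k !) : ℚ) = 1 / B (k + 1) + 1 / D (k + 1) := by
  have hends := sum_sub_sum_eq_of_eqOn_sdiff (s := {0, k, k + 1}) (t := range (k + 2))
    (f := fun i => (-1 : ℚ) ^ i / (D (i + 1) * B (k + 1 - i)))
    (g := fun i => 1 / 2 * ((-1 : ℚ) ^ i / (i ! * (k + 1 - i)!)))
    (fun i hi => by simp at hi ⊢; omega)
    fun i hi hi' => by
      simp only [mem_range, mem_insert, mem_singleton] at hi hi'
      rw [hD i (by omega) (by omega), hB (k + 1 - i) (by omega)]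
      push_cast
      ring
  rw [hsum, ← mul_sum, sum_neg_one_pow_div_factorial k.succ_ne_zero, sum_insert (by simp; omega),
    sum_pair k.lt_add_one.ne] at hends
  simp only [hk.neg_one_pow, hk.add_one.neg_one_pow, pow_zero, tsub_zero, tsub_self, zero_add,
    add_tsub_cancel_left, hD₁, hB 0 (by omega), hB 1 (by omega), Nat.factorial_zero,
    Nat.factorial_one, Nat.cast_one, one_mul, mul_one, neg_div] at hends
  rw [← one_add_one_eq_two (R := ℚ), add_div, one_add_one_eq_two, ← one_div_mul_one_div]
  linarith

lemma lt_four_of_eq_mul_factorial_of_even (hk : Even k) (hk₄ : 4 ≤ k)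
    (hB : ∀ i ≤ k, B i = i !) (hBle : (k + 1)! ≤ B (k + 1)) (hD₁ : D 1 = 1)
    (hD : ∀ i, i ≠ 0 → i < k → D (i + 1) = 2 * i !) (hDk : D (k + 1) = c * k !)
    (hsum : ∑ i ∈ range (k + 2), (-1 : ℚ) ^ i / (D (i + 1) * B (k + 1 - i)) = 1 / D (k + 2)) :
    c < 4 := by
  by_contra! hc
  have hrel := two_div_add_one_div_two_mul_factorial_of_even hk (by omega) hB hD₁ hD hsum
  have hfac : (0 : ℚ) < 1 / k ! := by positivity
  have hD' : (0 : ℚ) ≤ 2 / D (k + 2) := by positivity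
  have hB' : (1 / B (k + 1) : ℚ) ≤ 1 / 5 * (1 / k !) := by
    rw [one_div_mul_one_div]
    refine one_div_le_one_div_of_le (by positivity) ?_
    rw [Nat.factorial_succ] at hBle
    exact_mod_cast (Nat.mul_le_mul_right _ (by omega)).trans hBle
  have hDk' : (1 / D (k + 1) : ℚ) ≤ 1 / 4 * (1 / k !) := by
    rw [one_div_mul_one_div, hDk]
    refine one_div_le_one_div_of_le (by positivity) ?_
    exact_mod_cast Nat.mul_le_mul_right _ hc
  rw [← one_div_mul_one_div] at hrel
  linarith

end AlternatingSums

section Binomial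

variable {P : Type*} [PartialOrder P] [BoundedOrder P] [GradeMinOrder ℕ P] {B : ℕ → ℕ} {k : ℕ}

lemma grade_bot_eq_zero : grade ℕ (⊥ : P) = 0 := grade_bot

lemma ne_bot_of_grade_ne_zero {x : P} (h : grade ℕ x ≠ 0) : x ≠ ⊥ := fun hx =>
  h (hx ▸ grade_bot_eq_zero)

lemma IsBinomialFactorialFunction.numMaxChains_eq (hB : IsBinomialFactorialFunction P B) {x y : P}
    (hx : x ≠ ⊥) (hxy : x ≤ y) (hk : grade ℕ y = grade ℕ x + k) : numMaxChains x y = B k := by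
  rw [hB x y hx hxy, hk, Nat.add_sub_cancel_left]

variable [LocallyFiniteOrder P] {x y : P}

lemma exists_grade_eq_of_le_grade_top (hk : k ≤ grade ℕ (⊤ : P)) : ∃ x : P, grade ℕ x = k := by
  obtain ⟨x, -, -, hx⟩ := exists_grade_eq (bot_le : (⊥ : P) ≤ ⊤)
    ((congrArg (· + k) grade_bot_eq_zero).trans (zero_add k) |>.trans_le hk)
  exact ⟨x, by rw [hx, grade_bot_eq_zero, zero_add]⟩

lemma exists_ne_bot_le_grade_eq_add (hk : k < grade ℕ (⊤ : P)) :
    ∃ x y : P, x ≠ ⊥ ∧ x ≤ y ∧ grade ℕ y = grade ℕ x + k := by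
  obtain ⟨x, hx⟩ := exists_grade_eq_of_le_grade_top (P := P) (k := 1) (by omega)
  obtain ⟨y, hxy, -, hy⟩ := exists_grade_eq (le_top : x ≤ ⊤) (i := k) (by omega)
  exact ⟨x, y, ne_bot_of_grade_ne_zero (by omega), hxy, hy⟩

variable (P) in
/-- All intervals `[x, y]` of rank `k` with `x ≠ ⊥` are boolean lattices. -/
def HasBooleanIntervals (k : ℕ) : Prop :=
  ∀ x y : P, x ≠ ⊥ → x ≤ y → grade ℕ y = grade ℕ x + k → IsBooleanInterval x y

namespace IsBinomialFactorialFunction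

variable (hB : IsBinomialFactorialFunction P B)
include hB

lemma pos (hk : k < grade ℕ (⊤ : P)) : 0 < B k := by
  obtain ⟨x, y, hx, hxy, hr⟩ := exists_ne_bot_le_grade_eq_add hk
  exact hB.numMaxChains_eq hx hxy hr ▸ numMaxChains_pos x y

lemma zero (h : 0 < grade ℕ (⊤ : P)) : B 0 = 1 := by
  obtain ⟨x, -, hx, -⟩ := exists_ne_bot_le_grade_eq_add h
  rw [← hB.numMaxChains_eq hx le_rfl rfl, numMaxChains_self]

lemma card_atomsIn_mul (hx : x ≠ ⊥) (hxy : x ≤ y) (hk : grade ℕ y = grade ℕ x + (k + 1)) :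
    #(atomsIn x y) * B k = B (k + 1) := by
  have hlt : x < y := lt_of_le_of_ne hxy (by rintro rfl; omega)
  rw [← hB.numMaxChains_eq hx hxy hk, numMaxChains_eq_sum hlt, ← smul_eq_mul, ← sum_const]
  refine sum_congr rfl fun a ha => ?_
  obtain ⟨hxa, hay⟩ := mem_atomsIn.1 ha
  have := grade_of_covBy hxa
  exact (hB.numMaxChains_eq (ne_bot_of_le_ne_bot hx hxa.le) hay (by omega)).symm

lemma sum_neg_one_pow_div_eq_zero (hE : IsEulerianPoset P) (hk₀ : k ≠ 0)
    (hk : k < grade ℕ (⊤ : P)) :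
    ∑ i ∈ range (k + 1), (-1 : ℚ) ^ i / (B i * B (k - i)) = 0 := by
  obtain ⟨x, y, hx, hxy, hr⟩ := exists_ne_bot_le_grade_eq_add hk
  have hlt : x < y := lt_of_le_of_ne hxy (by rintro rfl; omega)
  refine mod_cast hE.sum_neg_one_pow_div_eq_zero hlt hr (w := fun i => B i * B (k - i))
    fun i z hz => ?_
  obtain ⟨hxz, hzy, hz⟩ := mem_levelIn.1 hz
  have := grade_mono (𝕆 := ℕ) hzy
  rw [hB.numMaxChains_eq hx hxz hz,
    hB.numMaxChains_eq (k := k - i) (ne_bot_of_le_ne_bot hx hxz) hzy (by omega)]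

lemma eq_factorial (h : ∀ i ≤ k, HasBooleanIntervals P i) (hk : k < grade ℕ (⊤ : P)) :
    B k = k ! := by
  induction k with
  | zero => exact hB.zero hk
  | succ k ih =>
    obtain ⟨x, y, hx, hxy, hr⟩ := exists_ne_bot_le_grade_eq_add hk
    have hcard := (h (k + 1) le_rfl x y hx hxy hr).grade_eq_add_card
    rw [← hB.card_atomsIn_mul hx hxy hr, ih (fun i hi => h i (by omega)) (by omega),
      Nat.factorial_succ]
    congr 1
    omega

lemma card_atomsIn_eq (hBk : ∀ i ≤ k, B i = i !) (hx : x ≠ ⊥) (hxy : x ≤ y)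
    (hk : grade ℕ y = grade ℕ x + k) : #(atomsIn x y) = k := by
  obtain - | k := k
  · rw [eq_of_le_of_grade_eq hxy hk.symm, atomsIn_self, card_empty]
  · have hmul := hB.card_atomsIn_mul hx hxy hk
    rw [hBk k k.le_succ, hBk (k + 1) le_rfl, Nat.factorial_succ] at hmul
    exact Nat.eq_of_mul_eq_mul_right k.factorial_pos hmul

variable (hB₃ : B 3 = 6)
include hB₃

lemma isLocallyBoolean (h : ∀ i < k, HasBooleanIntervals P i) (hk₃ : 3 ≤ k) (hx : x ≠ ⊥)
    (hxy : x ≤ y) (hk : grade ℕ y = grade ℕ x + k) : IsLocallyBoolean x y k where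
  three_le := hk₃
  le := hxy
  grade_eq := hk
  lower z hz := by
    obtain ⟨hxz, hzy⟩ := mem_Ico.1 hz
    have h₁ := grade_mono (𝕆 := ℕ) hxz
    have h₂ := grade_strictMono (𝕆 := ℕ) hzy
    exact h (grade ℕ z - grade ℕ x) (by omega) x z hx hxz (by omega)
  upper a ha := by
    obtain ⟨hxa, hay⟩ := mem_atomsIn.1 ha
    have := grade_of_covBy hxa
    exact h (k - 1) (by omega) a y (ne_bot_of_le_ne_bot hx hxa.le) hay (by omega)
  card_of_eq_three := by
    rintro rfl
    have hmul := hB.card_atomsIn_mul hx hxy hk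
    have htop := grade_mono (𝕆 := ℕ) (le_top : y ≤ ⊤)
    rw [hB₃, hB.eq_factorial (fun i hi => h i (by omega)) (by omega), Nat.factorial_two] at hmul
    omega

lemma eq_card_components_mul_factorial (h : ∀ i < k, HasBooleanIntervals P i) (hk₃ : 3 ≤ k)
    (hx : x ≠ ⊥) (hxy : x ≤ y) (hk : grade ℕ y = grade ℕ x + k) :
    B k = #(components x y) * k ! := by
  have htop := grade_mono (𝕆 := ℕ) (le_top : y ≤ ⊤)
  obtain ⟨j, rfl⟩ := Nat.exists_eq_add_of_le' (one_le_two.trans <| Nat.le_of_lt hk₃)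
  rw [← hB.card_atomsIn_mul hx hxy hk, hB.eq_factorial (fun i hi => h i (by omega)) (by omega),
    ← (hB.isLocallyBoolean hB₃ h hk₃ hx hxy hk).card_components_mul, Nat.factorial_succ, mul_assoc]

variable (hE : IsEulerianPoset P)
include hE

lemma eq_factorial_of_hasBooleanIntervals_lt (h : ∀ i < k, HasBooleanIntervals P i)
    (hk : k + 2 ≤ grade ℕ (⊤ : P)) : B k = k ! := by
  have hBlt : ∀ i < k, B i = i ! := fun i hi =>
    hB.eq_factorial (fun j hj => h j (hj.trans_lt hi)) (by omega)
  obtain rfl | hk₀ := eq_or_ne k 0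
  · exact hB.zero (by omega)
  obtain hev | hodd := Nat.even_or_odd k
  · exact eq_factorial_of_even hev hk₀ hBlt (hB.sum_neg_one_pow_div_eq_zero hE hk₀ (by omega))
  obtain ⟨x, y, hx, hxy, hr⟩ := exists_ne_bot_le_grade_eq_add (P := P) (k := k) (by omega)
  obtain rfl | hk₁ := eq_or_ne k 1
  · rw [← hB.card_atomsIn_mul hx hxy hr, hB.zero (by omega),
      atomsIn_eq_singleton (covBy_of_le_of_grade_eq_add_one hxy hr), card_singleton,
      Nat.factorial_one]
  have hk₃ : 3 ≤ k := by
    obtain ⟨r, rfl⟩ := hodd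
    omega
  have hBk := hB.eq_card_components_mul_factorial hB₃ h hk₃ hx hxy hr
  have hBpos := hB.pos (k := k) (by omega)
  rw [hBk, eq_one_of_eq_mul_factorial_of_odd hodd (by omega) hBlt hBk
    (left_ne_zero_of_mul (hBk ▸ hBpos.ne')) (hB.pos (by omega))
    (by simpa using hB.sum_neg_one_pow_div_eq_zero hE k.succ_ne_zero (by omega)), one_mul]

theorem hasBooleanIntervals (hk : k + 2 ≤ grade ℕ (⊤ : P)) : HasBooleanIntervals P k := by
  induction k using Nat.strong_induction_on with
  | _ k ih =>
    have h : ∀ i < k, HasBooleanIntervals P i := fun i hi => ih i hi (by omega)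
    have hBle : ∀ i ≤ k, B i = i ! := fun i hi =>
      hB.eq_factorial_of_hasBooleanIntervals_lt hB₃ hE (fun j hj => h j (by omega)) (by omega)
    intro x y hx hxy hr
    have hcard := hB.card_atomsIn_eq hBle hx hxy hr
    obtain hk₃ | hk₃ := Nat.lt_or_ge k 3
    · exact .of_grade_le_two hxy (by omega) (by omega)
    · exact (hB.isLocallyBoolean hB₃ h hk₃ hx hxy hr).isBooleanInterval_of_card_atomsIn_eq hcard

lemma eq_factorial_of_add_two_le (hk : k + 2 ≤ grade ℕ (⊤ : P)) : B k = k ! :=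
  hB.eq_factorial (fun _ _ => hB.hasBooleanIntervals hB₃ hE (by omega)) (by omega)

lemma factorial_le (hk₃ : 3 ≤ k) (hk : k < grade ℕ (⊤ : P)) : k ! ≤ B k := by
  obtain ⟨x, y, hx, hxy, hr⟩ := exists_ne_bot_le_grade_eq_add hk
  have hBk := hB.eq_card_components_mul_factorial hB₃
    (fun i hi => hB.hasBooleanIntervals hB₃ hE (by omega)) hk₃ hx hxy hr
  exact Nat.le_of_dvd (hB.pos hk) ⟨_, hBk.trans (mul_comm _ _)⟩

end IsBinomialFactorialFunction

end Binomial

section PairedAtoms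

lemma even_card_of_forall_existsUnique {α : Type*} {s : Finset α} {r : α → α → Prop}
    (hr : ∀ a b, r a b → r b a) (h : ∀ a ∈ s, ∃! b, b ∈ s ∧ b ≠ a ∧ r a b) : Even #s := by
  choose! σ hσ huniq using h
  have hinv : ∀ a ∈ s, σ (σ a) = a := fun a ha =>
    (huniq (σ a) (hσ a ha).1 a ⟨ha, (hσ a ha).2.1.symm, hr _ _ (hσ a ha).2.2⟩).symm
  have hsum : ∑ _a ∈ s, (1 : ZMod 2) = 0 :=
    sum_involution (fun a _ => σ a) (fun _ _ => CharTwo.add_self_eq_zero 1)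
      (fun a ha _ => (hσ a ha).2.1) (fun a ha => (hσ a ha).1) hinv
  rwa [sum_const, nsmul_one, ZMod.natCast_eq_zero_iff_even] at hsum

variable {P : Type*} [PartialOrder P] [LocallyFiniteOrder P] [GradeOrder ℕ P] {x y z w a : P}

lemma atomsIn_eq_of_forall_card_eq {c : ℕ} (hr : grade ℕ x + 4 ≤ grade ℕ y)
    (hbool : ∀ a ∈ atomsIn x y, IsBooleanInterval a y)
    (hcard : ∀ z ∈ Ioo x y, grade ℕ x + 2 ≤ grade ℕ z → #(atomsIn x z) = c)
    (hxa : x ⋖ a) (hz : z ∈ Ioo a y) (hw : w ∈ Ioo a y) : atomsIn x z = atomsIn x w := by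
  obtain ⟨⟨haz, hzy⟩, ⟨haw, hwy⟩⟩ := And.intro (mem_Ioo.1 hz) (mem_Ioo.1 hw)
  have hga := grade_of_covBy hxa
  have heq : ∀ p q, a < p → p ≤ q → q < y → atomsIn x p = atomsIn x q := fun p q hap hpq hqy => by
    have hgp := grade_strictMono (𝕆 := ℕ) hap
    have hgq := grade_mono (𝕆 := ℕ) hpq
    refine eq_of_subset_of_card_le (atomsIn_mono hpq) ?_
    rw [hcard p (mem_Ioo.2 ⟨hxa.lt.trans hap, hpq.trans_lt hqy⟩) (by omega),
      hcard q (mem_Ioo.2 ⟨hxa.lt.trans (hap.trans_le hpq), hqy⟩) (by omega)]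
  obtain ⟨p, hp⟩ := atomsIn_nonempty haz
  obtain ⟨q, hq⟩ := atomsIn_nonempty haw
  obtain ⟨⟨hap, hpz⟩, ⟨haq, hqw⟩⟩ := And.intro (mem_atomsIn.1 hp) (mem_atomsIn.1 hq)
  rw [← heq p z hap.lt hpz hzy, ← heq q w haq.lt hqw hwy]
  rcases eq_or_ne p q with rfl | hpq
  · rfl
  have hay : a ∈ atomsIn x y := mem_atomsIn.2 ⟨hxa, (haz.trans hzy).le⟩
  obtain ⟨r, hry, hpr, hqr⟩ := (hbool a hay).exists_common_covBy
    (atomsIn_mono hzy.le hp) (atomsIn_mono hwy.le hq) hpq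
  have hry' : r < y := lt_of_le_of_ne hry <| by
    rintro rfl
    have := grade_of_covBy hap
    have := grade_of_covBy hpr
    omega
  rw [heq p r hap.lt hpr.le hry', heq q r haq.lt hqr.le hry']

lemma even_card_atomsIn (hr : grade ℕ x + 4 ≤ grade ℕ y) (hxy : x ≤ y)
    (hbool : ∀ a ∈ atomsIn x y, IsBooleanInterval a y)
    (hcard : ∀ z ∈ Ioo x y, grade ℕ x + 2 ≤ grade ℕ z → #(atomsIn x z) = 2) :
    Even #(atomsIn x y) := by
  classical
  refine even_card_of_forall_existsUnique (r := Linked y) (fun _ _ => Linked.symm) fun a ha => ?_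
  obtain ⟨hxa, hay⟩ := mem_atomsIn.1 ha
  have hga := grade_of_covBy hxa
  obtain ⟨p, hp⟩ := atomsIn_nonempty (lt_of_le_of_ne hay (by rintro rfl; omega))
  obtain ⟨hap, hpy⟩ := mem_atomsIn.1 hp
  have hgp := grade_of_covBy hap
  have hpy' : p < y := lt_of_le_of_ne hpy (by rintro rfl; omega)
  obtain ⟨b, hb⟩ : ∃ b, (atomsIn x p).erase a = {b} := by
    rw [← card_eq_one, card_erase_of_mem (mem_atomsIn.2 ⟨hxa, hap.le⟩),
      hcard p (mem_Ioo.2 ⟨hxa.lt.trans hap.lt, hpy'⟩) (by omega)]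
  obtain ⟨hba, hbp⟩ := mem_erase.1 (hb.symm ▸ mem_singleton_self b)
  refine ⟨b, ⟨atomsIn_mono hpy hbp, hba, p, hpy', hap.le, (mem_atomsIn.1 hbp).2⟩, ?_⟩
  rintro c ⟨hc, hca, z, hzy, haz, hcz⟩
  have hxc := (mem_atomsIn.1 hc).1
  have haz' : a < z := lt_of_le_of_ne haz <| by
    rintro rfl
    exact hca (eq_of_le_of_grade_eq hcz (by rw [hga, grade_of_covBy hxc]))
  rw [← mem_singleton, ← hb, mem_erase, atomsIn_eq_of_forall_card_eq hr hbool hcard hxa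
    (mem_Ioo.2 ⟨hap.lt, hpy'⟩) (mem_Ioo.2 ⟨haz', hzy⟩)]
  exact ⟨hca, mem_atomsIn.2 ⟨hxc, hcz⟩⟩

end PairedAtoms

section Sheffer

variable {P : Type*} [PartialOrder P] [BoundedOrder P] [GradeMinOrder ℕ P]
  [LocallyFiniteOrder P] {B D : ℕ → ℕ} {y z : P} {k : ℕ}

namespace IsShefferFactorialFunction

variable (hD : IsShefferFactorialFunction P D)
include hD

lemma pos (hk : k ≤ grade ℕ (⊤ : P)) : 0 < D k := by
  obtain ⟨y, rfl⟩ := exists_grade_eq_of_le_grade_top hk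
  exact hD y ▸ numMaxChains_pos ⊥ y

variable (hB : IsBinomialFactorialFunction P B)
include hB

lemma card_atomsIn_mul (hy : grade ℕ y = k + 1) : #(atomsIn ⊥ y) * B k = D (k + 1) := by
  have hbot : ⊥ < y := bot_lt_iff_ne_bot.2 (ne_bot_of_grade_ne_zero (by omega))
  rw [← hy, ← hD y, numMaxChains_eq_sum hbot, ← smul_eq_mul, ← sum_const]
  refine sum_congr rfl fun a ha => ?_
  obtain ⟨hba, hay⟩ := mem_atomsIn.1 ha
  have hga := grade_of_covBy hba
  rw [grade_bot_eq_zero] at hga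
  exact (hB.numMaxChains_eq hba.ne' hay (by omega)).symm

lemma one (h : 0 < grade ℕ (⊤ : P)) : D 1 = 1 := by
  obtain ⟨y, hy⟩ := exists_grade_eq_of_le_grade_top (P := P) (k := 1) h
  rw [← hD.card_atomsIn_mul hB hy, hB.zero h, atomsIn_eq_singleton
    (covBy_of_le_of_grade_eq_add_one bot_le (by rw [hy, grade_bot_eq_zero])), card_singleton]

lemma card_atomsIn_eq_two (hy : grade ℕ y = k + 1) (hk : k < grade ℕ (⊤ : P))
    (hDk : D (k + 1) = 2 * B k) : #(atomsIn ⊥ y) = 2 :=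
  Nat.eq_of_mul_eq_mul_right (hB.pos hk) ((hD.card_atomsIn_mul hB hy).trans hDk)

lemma card_atomsIn_eq_two_of_forall_eq
    (h : ∀ k, k ≠ 0 → k + 1 ≤ grade ℕ (⊤ : P) → D (k + 1) = 2 * B k) (hy : 2 ≤ grade ℕ y) :
    #(atomsIn ⊥ y) = 2 := by
  have hle := grade_mono (𝕆 := ℕ) (le_top : y ≤ ⊤)
  obtain ⟨k, hk⟩ := Nat.exists_eq_add_of_le' (one_le_two.trans hy)
  exact hD.card_atomsIn_eq_two hB hk (by omega) (h k (by omega) (by omega))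

variable (hE : IsEulerianPoset P)
include hE

lemma sum_neg_one_pow_div_eq (hk : k + 1 ≤ grade ℕ (⊤ : P)) :
    ∑ i ∈ range (k + 1), (-1 : ℚ) ^ i / (D (i + 1) * B (k - i)) = 1 / D (k + 1) := by
  obtain ⟨y, hy⟩ := exists_grade_eq_of_le_grade_top hk
  let w : ℕ → ℕ
    | 0 => D (k + 1)
    | i + 1 => D (i + 1) * B (k - i)
  have hw : ∀ i, ∀ z ∈ levelIn ⊥ y i, numMaxChains ⊥ z * numMaxChains z y = w i := by
    rintro (- | i) z hz
    · obtain rfl := mem_singleton.1 (levelIn_zero (bot_le : ⊥ ≤ y) ▸ hz)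
      rw [numMaxChains_self, one_mul, hD, hy]
    · obtain ⟨-, hzy, hgz⟩ := mem_levelIn.1 hz
      rw [grade_bot_eq_zero, zero_add] at hgz
      have := grade_mono (𝕆 := ℕ) hzy
      rw [hD, hgz, hB.numMaxChains_eq (k := k - i) (ne_bot_of_grade_ne_zero (by omega)) hzy
        (by omega)]
  have hsum := hE.sum_neg_one_pow_div_eq_zero (bot_lt_iff_ne_bot.2
    (ne_bot_of_grade_ne_zero (by omega))) (by rw [hy, grade_bot_eq_zero, zero_add]) hw
  simp only [sum_range_succ' _ (k + 1), w, pow_succ, pow_zero, mul_neg_one, neg_div,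
    sum_neg_distrib, Nat.cast_mul] at hsum
  linarith

variable (hB₃ : B 3 = 6)
include hB₃

lemma eq_two_mul_of_odd (hodd : Odd k) (hk : k + 1 ≤ grade ℕ (⊤ : P))
    (hDlt : ∀ i, i ≠ 0 → i < k → D (i + 1) = 2 * i !) : D (k + 1) = 2 * B k :=
  _root_.eq_two_mul_of_odd hodd (fun _ _ => hB.eq_factorial_of_add_two_le hB₃ hE (by omega))
    (hD.one hB (by omega)) hDlt (hB.pos (by omega)) (hD.pos hk)
    (hD.sum_neg_one_pow_div_eq hB hE hk)

lemma even_card_atomsIn (hk₃ : 3 ≤ k) (hk : k + 1 < grade ℕ (⊤ : P)) (hy : grade ℕ y = k + 1)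
    (hDlt : ∀ i, i ≠ 0 → i < k → D (i + 1) = 2 * i !) : Even #(atomsIn ⊥ y) := by
  refine _root_.even_card_atomsIn (by rw [grade_bot_eq_zero]; omega) bot_le (fun a ha => ?_)
    fun z hz hgz => ?_
  · obtain ⟨hba, hay⟩ := mem_atomsIn.1 ha
    have hga := grade_of_covBy hba
    rw [grade_bot_eq_zero] at hga
    exact hB.hasBooleanIntervals (k := k) hB₃ hE (by omega) a y hba.ne' hay (by omega)
  · have hgy := grade_strictMono (𝕆 := ℕ) (mem_Ioo.1 hz).2
    rw [grade_bot_eq_zero] at hgz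
    refine hD.card_atomsIn_eq_two hB (k := grade ℕ z - 1) (by omega) (by omega) ?_
    rw [hDlt _ (by omega) (by omega), hB.eq_factorial_of_add_two_le hB₃ hE (by omega)]

variable (hD₃ : D 3 = 4)
include hD₃

theorem eq_two_mul_factorial (hk₀ : k ≠ 0) (hk : k + 2 ≤ grade ℕ (⊤ : P)) :
    D (k + 1) = 2 * k ! := by
  induction k using Nat.strong_induction_on with
  | _ k ih =>
    have hDlt : ∀ i, i ≠ 0 → i < k → D (i + 1) = 2 * i ! := fun i hi₀ hi =>
      ih i hi hi₀ (by omega)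
    have hBle : ∀ i ≤ k, B i = i ! := fun i _ =>
      hB.eq_factorial_of_add_two_le hB₃ hE (by omega)
    obtain hev | hodd := k.even_or_odd
    · obtain rfl | hk₄ : k = 2 ∨ 4 ≤ k := by
        obtain ⟨r, rfl⟩ := hev
        omega
      · exact hD₃
      obtain ⟨y, hy⟩ := exists_grade_eq_of_le_grade_top (P := P) (k := k + 1) (by omega)
      have hmul := hD.card_atomsIn_mul hB hy
      rw [hBle k le_rfl] at hmul
      have heven := hD.even_card_atomsIn hB hE hB₃ (by omega) (by omega) hy hDlt
      have hlt : #(atomsIn ⊥ y) < 4 := lt_four_of_eq_mul_factorial_of_even hev hk₄ hBle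
        (hB.factorial_le hB₃ hE (by omega) (by omega)) (hD.one hB (by omega)) hDlt hmul.symm
        (hD.sum_neg_one_pow_div_eq hB hE (by omega))
      have hpos : 0 < #(atomsIn ⊥ y) :=
        Nat.pos_of_mul_pos_right (hmul ▸ hD.pos (by omega) : 0 < #(atomsIn ⊥ y) * k !)
      obtain ⟨r, hr⟩ := heven
      rw [← hmul, show #(atomsIn ⊥ y) = 2 by omega]
    · rw [hD.eq_two_mul_of_odd hB hE hB₃ hodd (by omega) hDlt, hBle k le_rfl]

theorem eq_two_mul (heven : Even (grade ℕ (⊤ : P))) (hk₀ : k ≠ 0)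
    (hk : k + 1 ≤ grade ℕ (⊤ : P)) : D (k + 1) = 2 * B k := by
  obtain hk | hk := hk.lt_or_eq
  · rw [hD.eq_two_mul_factorial hB hE hB₃ hD₃ hk₀ hk, hB.eq_factorial_of_add_two_le hB₃ hE hk]
  · rw [← hk, Nat.even_add_one, Nat.not_even_iff_odd] at heven
    exact hD.eq_two_mul_of_odd hB hE hB₃ heven hk.le fun i hi₀ hi =>
      hD.eq_two_mul_factorial hB hE hB₃ hD₃ hi₀ (by omega)

end IsShefferFactorialFunction

end Sheffer

section OrderIso

variable {X Y Z : Type*} [PartialOrder X] [PartialOrder Y] [PartialOrder Z]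

lemma nonempty_withBot_orderIso_of_range_eq [OrderBot Z] (f : X ↪o Z)
    (hf : Set.range f = {⊥}ᶜ) : Nonempty (WithBot X ≃o Z) := by
  classical
  exact ⟨(f.orderIso.trans (OrderIso.setCongr _ _ hf)).withBotCongr.trans WithBot.subtypeOrderIso⟩

lemma nonempty_withTop_orderIso_of_range_eq [OrderTop Z] (f : X ↪o Z)
    (hf : Set.range f = {⊤}ᶜ) : Nonempty (WithTop X ≃o Z) := by
  classical
  exact ⟨(f.orderIso.trans (OrderIso.setCongr _ _ hf)).withTopCongr.trans WithTop.subtypeOrderIso⟩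

lemma nonempty_withTop_orderIso_Ioi [OrderTop Z] {a : Z} (ha : a < ⊤) (e : X ≃o Set.Ioo a ⊤) :
    Nonempty (WithTop X ≃o Set.Ioi a) := by
  let _ : OrderTop (Set.Ioi a) := { top := ⟨⊤, ha⟩, le_top := fun z => le_top (a := z.1) }
  let ι : Set.Ioo a ⊤ ↪o Set.Ioi a :=
    OrderEmbedding.ofMapLEIff (Set.inclusion Set.Ioo_subset_Ioi_self) fun _ _ => Iff.rfl
  refine nonempty_withTop_orderIso_of_range_eq (e.toOrderEmbedding.trans ι) ?_
  refine (e.surjective.range_comp ι).trans ((Set.range_inclusion Set.Ioo_subset_Ioi_self).trans ?_)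
  ext z
  refine ⟨fun hz htop => hz.2.ne (congrArg Subtype.val htop), fun hz => ⟨z.2, ?_⟩⟩
  exact lt_top_iff_ne_top.2 fun htop => hz (Subtype.ext htop)

lemma nonempty_orderIso_Ioi_bot_withBot (X : Type*) [PartialOrder X] :
    Nonempty (X ≃o Set.Ioi (⊥ : WithBot X)) :=
  ⟨WithBot.coeOrderHom.orderIso.trans (OrderIso.setCongr _ _ WithBot.range_coe)⟩

lemma exists_orderEmbedding_sum_range_eq (f : X ↪o Z) (g : Y ↪o Z) (hfg : ∀ x y, ¬ f x ≤ g y)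
    (hgf : ∀ x y, ¬ g y ≤ f x) : ∃ F : X ⊕ Y ↪o Z, Set.range F = Set.range f ∪ Set.range g := by
  refine ⟨OrderEmbedding.ofMapLEIff (Sum.elim f g) ?_, Set.Sum.elim_range f g⟩
  rintro (x | x) (y | y) <;> simp [hfg, hgf]

lemma exists_orderEmbedding_sumLex_range_eq (f : X ↪o Z) (g : Y ↪o Z) (h : ∀ x y, f x < g y) :
    ∃ F : X ⊕ₗ Y ↪o Z, Set.range F = Set.range f ∪ Set.range g := by
  refine ⟨OrderEmbedding.ofMapLEIff (fun s => Sum.elim f g (ofLex s)) ?_, ?_⟩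
  · rintro (x | x) (y | y)
    · exact f.le_iff_le.trans Sum.Lex.inl_le_inl_iff.symm
    · exact iff_of_true (h x y).le (Sum.Lex.inl_le_inr x y)
    · exact iff_of_false (h y x).not_ge Sum.Lex.not_inr_le_inl
    · exact g.le_iff_le.trans Sum.Lex.inr_le_inr_iff.symm
  · exact (ofLex.surjective.range_comp _).trans (Set.Sum.elim_range f g)

lemma nonempty_orderIso_dualSuspension [OrderBot X] [OrderBot Z] {a b : Z} (ha : IsAtom a)
    (hb : IsAtom b) (hab : a ≠ b) (h : ∀ z, z ≠ ⊥ → z ≠ a → z ≠ b → a < z ∧ b < z)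
    (e : Set.Ioi (⊥ : X) ≃o Set.Ioi a) : Nonempty (Z ≃o DualSuspension X) := by
  have hb_lt : ∀ z, a < z → b < z := fun z hz =>
    (h z (bot_le.trans_lt hz).ne' hz.ne' (by rintro rfl; exact ha.1 (hb.2 a hz))).2
  let const (c : Z) : Unit ↪o Z := OrderEmbedding.ofMapLEIff (fun _ => c) (by simp)
  obtain ⟨f, hf⟩ := exists_orderEmbedding_sum_range_eq (const a) (const b)
    (fun _ _ => mt (hb.le_iff_eq ha.1).1 hab) fun _ _ => mt (ha.le_iff_eq hb.1).1 hab.symm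
  let g : Set.Ioi (⊥ : X) ↪o Z := e.toOrderEmbedding.trans (OrderEmbedding.subtype _)
  have hg : Set.range g = Set.Ioi a :=
    (e.surjective.range_comp Subtype.val).trans Subtype.range_val
  have hf' : Set.range f = {a, b} := hf.trans (by
    rw [show Set.range (const a) = {a} from Set.range_const,
      show Set.range (const b) = {b} from Set.range_const, Set.singleton_union])
  have hfg : ∀ x y, f x < g y := fun x y => by
    have hy : a < g y := (e y).2
    obtain hx | hx : f x = a ∨ f x = b := hf'.subset (Set.mem_range_self x)
    exacts [hx ▸ hy, hx ▸ hb_lt _ hy]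
  obtain ⟨F, hF⟩ := exists_orderEmbedding_sumLex_range_eq f g hfg
  refine (nonempty_withBot_orderIso_of_range_eq F ?_).map OrderIso.symm
  ext z
  rw [hF, hf', hg]
  refine ⟨?_, fun hz => ?_⟩
  · rintro ((rfl | rfl) | hz)
    exacts [ha.1, hb.1, (bot_le.trans_lt hz).ne']
  · by_contra hz'
    simp only [Set.mem_union, Set.mem_insert_iff, Set.mem_singleton_iff, Set.mem_Ioi,
      not_or] at hz'
    exact hz'.2 (h z hz hz'.1.1 hz'.1.2).1

lemma nonempty_orderIso_dualSuspension_withBot_withTop [BoundedOrder Z] {a b : Z} (ha : IsAtom a)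
    (hb : IsAtom b) (hab : a ≠ b) (h : ∀ z, z ≠ ⊥ → z ≠ a → z ≠ b → a < z ∧ b < z)
    (e : X ≃o Set.Ioo a ⊤) : Nonempty (Z ≃o DualSuspension (WithBot (WithTop X))) := by
  have ha_lt : a < ⊤ := lt_top_iff_ne_top.2 fun htop =>
    hab ((ha.le_iff_eq hb.1).1 (le_top.trans_eq htop.symm)).symm
  obtain ⟨e'⟩ := nonempty_withTop_orderIso_Ioi ha_lt e
  obtain ⟨i⟩ := nonempty_orderIso_Ioi_bot_withBot (WithTop X)
  exact nonempty_orderIso_dualSuspension ha hb hab h (i.symm.trans e')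

end OrderIso

section TwoAtoms

variable {P : Type*} [PartialOrder P] [BoundedOrder P] [GradeMinOrder ℕ P]
  [LocallyFiniteOrder P] {B D : ℕ → ℕ} {y : P}

lemma exists_isAtom_pair_lt (htop : 2 ≤ grade ℕ (⊤ : P))
    (h : ∀ y : P, 2 ≤ grade ℕ y → #(atomsIn ⊥ y) = 2) :
    ∃ a b : P, IsAtom a ∧ IsAtom b ∧ a ≠ b ∧ ∀ z, z ≠ ⊥ → z ≠ a → z ≠ b → a < z ∧ b < z := by
  classical
  obtain ⟨a, b, hab, hatoms⟩ := card_eq_two.1 (h ⊤ htop)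
  have hmem : ∀ z, ⊥ ⋖ z ↔ z = a ∨ z = b := fun z => by
    rw [← mem_singleton (a := b), ← mem_insert, ← hatoms, mem_atomsIn, and_iff_left le_top]
  obtain ⟨ha, hb⟩ := And.intro ((hmem a).2 (.inl rfl)) ((hmem b).2 (.inr rfl))
  refine ⟨a, b, bot_covBy_iff.1 ha, bot_covBy_iff.1 hb, hab, fun z hz hza hzb => ?_⟩
  have hgz : 2 ≤ grade ℕ z := by
    by_contra! hlt
    have hpos := grade_strictMono (𝕆 := ℕ) (bot_lt_iff_ne_bot.2 hz)
    rw [grade_bot_eq_zero] at hpos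
    have hcov : ⊥ ⋖ z := covBy_of_le_of_grade_eq_add_one bot_le (by rw [grade_bot_eq_zero]; omega)
    exact ((hmem z).1 hcov).elim hza hzb
  have hsub : {a, b} ⊆ atomsIn ⊥ z := by
    rw [← hatoms]
    exact (eq_of_subset_of_card_le (atomsIn_mono le_top) (by rw [h z hgz, h ⊤ htop])).ge
  rw [insert_subset_iff, singleton_subset_iff, mem_atomsIn, mem_atomsIn] at hsub
  exact ⟨lt_of_le_of_ne hsub.1.2 hza.symm, lt_of_le_of_ne hsub.2.2 hzb.symm⟩

end TwoAtoms

theorem mainTheorem4 {P : Type*} [PartialOrder P] [BoundedOrder P] [GradeMinOrder ℕ P]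
    (m : ℕ) (hm : 4 ≤ 2 * m + 2) (hrank : grade ℕ (⊤ : P) = 2 * m + 2)
    (hE : IsEulerianPoset P) (hS : IsShefferPoset P)
    (B D : ℕ → ℕ) (hB : IsBinomialFactorialFunction P B) (hD : IsShefferFactorialFunction P D)
    (hB3 : B 3 = 6) (hD3 : D 3 = 4) :
    ∃ α : ℕ, 0 < α ∧
      B (2 * m + 1) = α * (2 * m + 1).factorial ∧
      Nonempty (P ≃o DualSuspension (KSummation α (BooleanLattice (2 * m + 1)))) ∧
      (∀ k : ℕ, 1 ≤ k → k ≤ 2 * m → B k = k.factorial) ∧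
      D 1 = 1 ∧
      (∀ k : ℕ, 2 ≤ k → k ≤ 2 * m + 1 → D k = 2 * (k - 1).factorial) ∧
      D (2 * m + 2) = 2 * α * (2 * m + 1).factorial := by
  classical
  have := hS.finite
  have := Fintype.ofFinite P
  have : LocallyFiniteOrder P := Fintype.toLocallyFiniteOrder
  have hDB : ∀ k, k ≠ 0 → k + 1 ≤ grade ℕ (⊤ : P) → D (k + 1) = 2 * B k := fun k hk₀ hk =>
    hD.eq_two_mul hB hE hB3 hD3 ⟨m + 1, by omega⟩ hk₀ hk
  obtain ⟨a, b, ha, hb, hab, hlt⟩ := exists_isAtom_pair_lt (P := P) (by omega) fun y hy =>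
    hD.card_atomsIn_eq_two_of_forall_eq hB hDB hy
  have hga : grade ℕ (⊤ : P) = grade ℕ a + (2 * m + 1) := by
    rw [grade_of_covBy (bot_covBy_iff.2 ha), grade_bot_eq_zero]; omega
  have hbool : ∀ k < 2 * m + 1, HasBooleanIntervals P k := fun k hk =>
    hB.hasBooleanIntervals hB3 hE (by omega)
  have hα : B (2 * m + 1) = #(components a ⊤) * (2 * m + 1)! :=
    hB.eq_card_components_mul_factorial hB3 hbool (by omega) ha.1 le_top hga
  obtain ⟨e⟩ := (hB.isLocallyBoolean hB3 hbool (by omega) ha.1 le_top hga).nonempty_orderIso_Ioo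
  refine ⟨#(components a ⊤), Nat.pos_of_mul_pos_right (hα ▸ hB.pos (by omega)), hα,
    nonempty_orderIso_dualSuspension_withBot_withTop ha hb hab hlt e,
    fun k _ hk => hB.eq_factorial_of_add_two_le hB3 hE (by omega), hD.one hB (by omega),
    fun k hk₂ hk => ?_, ?_⟩
  · obtain ⟨k, rfl⟩ := Nat.exists_eq_add_of_le' (one_le_two.trans hk₂)
    exact hD.eq_two_mul_factorial hB hE hB3 hD3 (by omega) (by omega)
  · rw [hDB (2 * m + 1) (by omega) (by omega), hα, mul_assoc]
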